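/- Let $V$ be a finite set of points in the plane and let $S$ be a finite set of simple polygons (obstacles) whose corners all belong to $V$ and whose closed regions are pairwise disjoint. Assume general position: no three points of $V$ are collinear, and no line through two points of $V$ makes an angle of $0$, $\pi/3$ or $2\pi/3$ with the horizontal axis. Two distinct points $u,v\in V$ are visible to each other if the segment $uv$ does not meet the interior of any obstacle. The visibility graph $Vis(V,S)$ has vertex set $V$ and joins all visible pairs. For $i\in\{0,1,2\}$ the positive cone $C_i^u$ is the cone with apex $u$ and opening angle $\pi/3$ whose bisector has polar angle $\pi/2+2\pi i/3$. If $u$ is a corner of an obstacle that, near $u$, lies inside $C^u_i$, this obstacle splits $C^u_i$ into two subcones, one on each side of it; otherwise $C^u_i$ has a single subcone. That is, two points visible from $u$ in $C_i^u$ lie in the same subcone if and only if no obstacle's interior is entered, arbitrarily close to $u$, by a ray from $u$ between the two points. The polygon-constrained half-$\Theta_6$-graph $G_\infty$ has vertex set $V$; for every $u\in V$ and every subcone of a positive cone $C_i^u$ that contains points of $V$ visible from $u$, it contains the undirected edge from $u$ to that visible point of $V$ in the subcone whose orthogonal projection on the bisector of $C_i^u$ is closest to $u$. Then: 1. $G_\infty$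 is plane: drawn with straight segments, no edge passes through a vertex other than its endpoints, and two distinct edges meet at most in a common endpoint. 2. $G_\infty$ is a $2$-spanner of $Vis(V,S)$: it is a subgraph of $Vis(V,S)$, and $d_{G_\infty}(x,y)\le 2\,d_{Vis(V,S)}(x,y)$ for all $x,y\in V$, where $d_G(x,y)$ is the least Euclidean length of a path from $x$ to $y$ in $G$ ($\infty$ if there is none). 3. For every edge $uv$ of $Vis(V,S)$, $v$ lies in a positive cone of $u$ or $u$ lies in a positive cone of $v$. Whenever $u,v\in V$ are joined by an edge of $Vis(V,S)$ and $v\in C_i^u$, let $a,b$ be the points where the line through $v$ perpendicular to the bisector of $C^u_i$ meets the two boundary rays of $C_i^u$, and let $m$ be the midpoint of $ab$. Then $G_\infty$ contains a path from $u$ to $v$ of length at most $$(\sqrt3\cos\angle muv+\sin\angle muv)\,|uv|\ \le\ 2\,|uv|.$$ -/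

import Mathlib

open Real EuclideanGeometry Topology
open scoped ENNReal

/-- The Euclidean plane. -/
abbrev Plane : Type := EuclideanSpace ℝ (Fin 2)

noncomputable section

/-! ### Polygonal obstacles -/

/-- A simple polygon: at least three corners, pairwise distinct, listed in cyclic order, such that
two different edges meet at most in a common endpoint. -/
structure SimplePolygon where
  /-- the number of corners -/
  n : ℕ
  three_le : 3 ≤ n
  /-- the closed polygonal chain -/
  poly : Polygon Plane n
  injective_vertices : Function.Injective poly.vertices
  edge_inter : ∀ i j : Fin n, i ≠ j →
    poly.edgeSet ℝ i ∩ poly.edgeSet ℝ j ⊆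
      {poly i, poly (finRotate n i)} ∩ {poly j, poly (finRotate n j)}

namespace SimplePolygon

/-- The set of corners. -/
def corners (P : SimplePolygon) : Set Plane := Set.range P.poly.vertices

/-- The boundary curve, i.e. the union of the edges. -/
def boundary (P : SimplePolygon) : Set Plane := P.poly.boundary ℝ

/-- The interior of a simple polygon: the points off the boundary curve that lie in a bounded
connected component of its complement. -/
def inside (P : SimplePolygon) : Set Plane :=
  {x | x ∉ P.boundary ∧ Bornology.IsBounded (connectedComponentIn P.boundaryᶜ x)}

/-- The closed polygonal region. -/
def region (P : SimplePolygon) : Set Plane := P.boundary ∪ P.inside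

end SimplePolygon

/-- `S` is an admissible set of obstacles for the point set `V`: all corners are points of `V`, and
no two obstacles intersect (as closed regions; in particular they are vertex-disjoint). -/
def IsObstacleSet (V : Finset Plane) (S : Finset SimplePolygon) : Prop :=
  (∀ P ∈ S, P.corners ⊆ (V : Set Plane)) ∧
  (∀ P ∈ S, ∀ Q ∈ S, P ≠ Q → Disjoint P.region Q.region)

/-! ### Visibility -/

/-- `u` and `v` see each other: the segment between them avoids the interior of every obstacle. -/
def Visible (S : Finset SimplePolygon) (u v : Plane) : Prop :=
  ∀ P ∈ S, Disjoint (segment ℝ u v) P.inside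

/-- The visibility graph `Vis(V, S)`. -/
def visibilityGraph (V : Finset Plane) (S : Finset SimplePolygon) : SimpleGraph V :=
  SimpleGraph.fromRel fun u v : V => Visible S u v

/-! ### Cones and general position -/

/-- The unit vector of polar angle `θ`. -/
def unitDir (θ : ℝ) : Plane := !₂[cos θ, sin θ]

/-- The polar angle of the bisector of the `i`-th positive cone; `C₀` has a vertical bisector. -/
def bisectorAngle (i : Fin 3) : ℝ := π / 2 + (i : ℕ) * (2 * π / 3)

/-- The unit vector along the bisector of the `i`-th positive cone. -/
def bisector (i : Fin 3) : Plane := unitDir (bisectorAngle i)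

/-- The unit vector along the counterclockwise (left) boundary ray of the `i`-th positive cone. -/
def leftBoundary (i : Fin 3) : Plane := unitDir (bisectorAngle i + π / 6)

/-- The unit vector along the clockwise (right) boundary ray of the `i`-th positive cone. -/
def rightBoundary (i : Fin 3) : Plane := unitDir (bisectorAngle i - π / 6)

/-- The `i`-th positive cone with apex `u`, of opening angle `π / 3` (without its apex). -/
def positiveCone (u : Plane) (i : Fin 3) : Set Plane :=
  {x | x ≠ u ∧ InnerProductGeometry.angle (x - u) (bisector i) ≤ π / 6}

/-- General position: no two points lie on a line parallel to a cone boundary, and no three points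
are collinear. -/
def GeneralPosition (V : Finset Plane) : Prop :=
  (∀ u ∈ V, ∀ v ∈ V, u ≠ v → ∀ i : Fin 3, ∀ c : ℝ,
    v - u ≠ c • leftBoundary i ∧ v - u ≠ c • rightBoundary i) ∧
  (∀ a ∈ V, ∀ b ∈ V, ∀ c ∈ V, a ≠ b → b ≠ c → a ≠ c → ¬ Collinear ℝ {a, b, c})

/-! ### The polygon-constrained half-`Θ₆`-graph -/

/-- The ray from `u` towards `x` does not start out in the interior of an obstacle. -/
def IsFreeDirection (S : Finset SimplePolygon) (u x : Plane) : Prop :=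
  ∀ P ∈ S, ∀ᶠ t in 𝓝[>] (0 : ℝ), AffineMap.lineMap u x t ∉ P.inside

/-- The subcone of the `i`-th positive cone of `u` that contains `v`: all points `w` of the cone
such that no obstacle starts at `u` between the directions `uv` and `uw`. So an obstacle with a
corner at `u` that lies, near `u`, inside the cone splits it into the part to its left and the part
to its right. -/
def subcone (S : Finset SimplePolygon) (u : Plane) (i : Fin 3) (v : Plane) : Set Plane :=
  {w | w ∈ positiveCone u i ∧ ∀ x ∈ segment ℝ v w, IsFreeDirection S u x}

/-- The signed length of the projection of `v - u` on the bisector of the `i`-th positive cone; for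
`v` in the `i`-th positive cone of `u` it is the distance from `u` of the projection of `v`. -/
def projLength (u : Plane) (i : Fin 3) (v : Plane) : ℝ := inner ℝ (bisector i) (v - u)

/-- Among the points of `V` that are visible from `u` and lie in the same subcone of the `i`-th
positive cone of `u` as `v`, the visible point `v` has the closest projection on the bisector. -/
def IsClosestInSubcone (V : Finset Plane) (S : Finset SimplePolygon) (u : Plane) (i : Fin 3)
    (v : Plane) : Prop :=
  v ∈ positiveCone u i ∧ Visible S u v ∧
    ∀ w ∈ V, w ≠ v → w ∈ subcone S u i v → Visible S u w → projLength u i v < projLength u i w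

/-- The polygon-constrained half-`Θ₆`-graph `G_∞`: in each positive subcone of each point an
(undirected) edge to the visible point with the closest projection. -/
def halfThetaSix (V : Finset Plane) (S : Finset SimplePolygon) : SimpleGraph V :=
  SimpleGraph.fromRel fun u v : V => ∃ i : Fin 3, IsClosestInSubcone V S u i v

/-! ### Geometric graphs -/

/-- The Euclidean length of a walk. -/
def walkLength {V : Finset Plane} {G : SimpleGraph V} {x y : V} (p : G.Walk x y) : ℝ :=
  (p.darts.map fun d => dist (d.fst : Plane) (d.snd : Plane)).sum

/-- The weighted graph distance (`∞` if there is no walk). -/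
def graphDist {V : Finset Plane} (G : SimpleGraph V) (x y : V) : ℝ≥0∞ :=
  ⨅ p : G.Walk x y, ENNReal.ofReal (walkLength p)

/-- `H` is a `t`-spanner of `G`. -/
def IsSpanner {V : Finset Plane} (t : ℝ≥0∞) (H G : SimpleGraph V) : Prop :=
  H ≤ G ∧ ∀ x y : V, graphDist H x y ≤ t * graphDist G x y

/-- A geometric graph is plane if no edge passes through a vertex other than its endpoints and two
different edges meet at most in a common endpoint. -/
def IsPlane {V : Finset Plane} (G : SimpleGraph V) : Prop :=
  (∀ a b w : V, G.Adj a b → (w : Plane) ∈ segment ℝ (a : Plane) (b : Plane) → w = a ∨ w = b) ∧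
  (∀ a b c d : V, G.Adj a b → G.Adj c d → s(a, b) ≠ s(c, d) →
    segment ℝ (a : Plane) (b : Plane) ∩ segment ℝ (c : Plane) (d : Plane) ⊆
      {(a : Plane), (b : Plane)} ∩ {(c : Plane), (d : Plane)})

/-! ### Canonical triangles -/

/-- The left corner of the canonical triangle of `u` and `v`: the point where the left boundary ray
of the `i`-th positive cone of `u` meets the line through `v` perpendicular to the bisector. -/
def canonicalLeft (u : Plane) (i : Fin 3) (v : Plane) : Plane :=
  u + (projLength u i v / cos (π / 6)) • leftBoundary i

/-- The right corner of the canonical triangle of `u` and `v`. -/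
def canonicalRight (u : Plane) (i : Fin 3) (v : Plane) : Plane :=
  u + (projLength u i v / cos (π / 6)) • rightBoundary i

/-- The midpoint of the side opposite to `u` of the canonical triangle of `u` and `v`. -/
def canonicalMid (u : Plane) (i : Fin 3) (v : Plane) : Plane :=
  midpoint ℝ (canonicalLeft u i v) (canonicalRight u i v)

end

/-!
The only topological fact about simple polygons that is needed is that each edge borders the
interior (`SimplePolygon.eventually_inside_of_transversal`). The winding number of the boundary
curve vanishes outside the polygon, being locally constant and zero at infinity, but it jumps by
one across each edge; so the two sides of an edge cannot both be outside. Hence visible segments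
are not crossed by edges of obstacles (`Visible.not_crossed`), and the directions at a corner next
to an edge are not all free. If two sides of a triangle are visible, no obstacle starts at their
common corner into the triangle, and all other points of `V` in the triangle lie on the third
side, then no obstacle meets the triangle (`disjoint_triangle_inside`): an edge inside it would
have to leave it somewhere. In a triangle `a`, `b`, `d` with visible sides `ab` and `ad` one can
therefore cut off, with the ray from `b` towards the first point of `V` in the triangle, a part
free of obstacles (`exists_first_point`).

*Planarity.* If two edges cross at `x`, an end `y` of one of them lies in the canonical triangle
of the other, say `uv` (`exists_end_mem`). Both `u` and `y` are visible from `x`, and the first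
point of `V` in the triangle `x`, `u`, `y` is visible from `u`, lies in the same subcone as `v`,
and is closer.

*Spanning ratio.* Let `w` be visible from `u` in a positive cone, and let `v` be the closest
visible point in its subcone. Repeated use of `exists_first_point` gives a convex chain of visible
segments from `v` to `w` in the triangle `u`, `v`, `w` (`exists_convexChain`). By induction on the
size of the canonical triangle (`walkBound`), the distance of `u` and `w` is at most the way along
the sides of this triangle around its farther corner, and around a given corner if the part of the
triangle on the other side of `uw` contains no points of `V`. These bounds are linear forms in the
triangular coordinates `coord`, so that the bounds for the steps of the chain telescope; convexity
ensures that the chain changes its horizontal direction at most once. The way around the farther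
corner is `(√3 cos α + sin α) |uw|`.
-/

/-! ### The winding number of a polygon -/

/-- The cross product (signed area form) of two plane vectors. -/
def cross (z w : Plane) : ℝ := z 0 * w 1 - z 1 * w 0

lemma isClosed_segment_plane (A B : Plane) : IsClosed (segment ℝ A B) := by
  rw [segment_eq_image]
  exact (isCompact_Icc.image (by fun_prop)).isClosed

lemma cross_eq_zero_of_mem_segment {A B x : Plane} (h : x ∈ segment ℝ A B) :
    cross (B - A) (x - A) = 0 := by
  rw [segment_eq_image_lineMap] at h
  obtain ⟨t, -, rfl⟩ := h
  simp [cross, AffineMap.lineMap_apply]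
  ring

lemma tendsto_add_smul (q d : Plane) :
    Filter.Tendsto (fun t : ℝ => q + t • d) (𝓝[>] 0) (𝓝 q) := by
  have h : ContinuousAt (fun t : ℝ => q + t • d) 0 := by fun_prop
  simpa using h.tendsto.mono_left nhdsWithin_le_nhds

/-- The plane as the complex line. -/
noncomputable def toComplex : Plane ≃ₗᵢ[ℝ] ℂ := Complex.orthonormalBasisOneI.repr.symm

lemma toComplex_re (z : Plane) : (toComplex z).re = z 0 := by
  simp [toComplex]

lemma toComplex_im (z : Plane) : (toComplex z).im = z 1 := by
  simp [toComplex]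

/-- The quotient of the vectors from `x` to `B` and to `A`; its argument is the oriented angle under
which the segment from `A` to `B` appears from `x`. -/
noncomputable def viewRatio (A B x : Plane) : ℂ :=
  (toComplex B - toComplex x) / (toComplex A - toComplex x)

lemma viewRatio_mem_slitPlane {A B x : Plane} (h : x ∉ segment ℝ A B) :
    viewRatio A B x ∈ Complex.slitPlane := by
  have hA : A ≠ x := by rintro rfl; exact h (left_mem_segment ℝ _ _)
  have hA' : toComplex A - toComplex x ≠ 0 := by
    simpa [sub_eq_zero] using hA
  by_contra hs
  rw [Complex.mem_slitPlane_iff_not_le_zero, not_not] at hs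
  rw [Complex.le_def] at hs
  obtain ⟨h1, h2⟩ := hs
  simp only [Complex.zero_re, Complex.zero_im] at h1 h2
  set q := -(viewRatio A B x).re with hq
  have hq0 : 0 ≤ q := by linarith
  have e : viewRatio A B x = ((-q : ℝ) : ℂ) := by
    apply Complex.ext <;> simp [hq, h2]
  rw [viewRatio, div_eq_iff hA'] at e
  apply h
  rw [segment_eq_image]
  refine ⟨1 / (1 + q), ⟨by positivity, by rw [div_le_one (by positivity)]; linarith⟩, ?_⟩
  apply toComplex.injective
  have hq1 : ((1 + q : ℝ) : ℂ) ≠ 0 := by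
    exact_mod_cast (by positivity : (1 + q) ≠ 0)
  have e2 : toComplex B + (q : ℂ) * toComplex A = ((1 + q : ℝ) : ℂ) * toComplex x := by
    push_cast at e ⊢
    linear_combination e
  simp only [map_add, LinearIsometryEquiv.map_smul, Complex.real_smul]
  have : toComplex x = (toComplex B + (q : ℂ) * toComplex A) / ((1 + q : ℝ) : ℂ) := by
    rw [e2]; field_simp
  rw [this]
  push_cast at hq1 ⊢
  field_simp
  ring

lemma continuousAt_viewRatio {A B x : Plane} (hA : A ≠ x) : ContinuousAt (viewRatio A B) x := by
  unfold viewRatio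
  refine ContinuousAt.div (by fun_prop) (by fun_prop) ?_
  simpa [sub_eq_zero] using hA

lemma continuousAt_arg_viewRatio {A B x : Plane} (h : x ∉ segment ℝ A B) :
    ContinuousAt (fun y => (viewRatio A B y).arg) x := by
  have hA : A ≠ x := by rintro rfl; exact h (left_mem_segment ℝ _ _)
  exact ContinuousAt.comp (f := viewRatio A B)
    (Complex.continuousAt_arg (viewRatio_mem_slitPlane h)) (continuousAt_viewRatio hA)

lemma tendsto_arg_viewRatio_cobounded (A B : Plane) :
    Filter.Tendsto (fun y => (viewRatio A B y).arg) (Bornology.cobounded Plane) (𝓝 0) := by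
  have h1 : Filter.Tendsto (fun y : Plane => toComplex A - toComplex y) (Bornology.cobounded Plane)
      (Bornology.cobounded ℂ) := by
    have := toComplex.isometry.antilipschitz.tendsto_cobounded
    exact (tendsto_const_sub_cobounded (toComplex A)).comp this
  have h2 := (Filter.tendsto_inv₀_cobounded (α := ℂ)).comp h1
  have h3 : Filter.Tendsto
      (fun y : Plane => 1 + (toComplex B - toComplex A) * (toComplex A - toComplex y)⁻¹)
      (Bornology.cobounded Plane) (𝓝 1) := by
    simpa using (h2.const_mul (toComplex B - toComplex A)).const_add 1
  have h4 : ∀ᶠ y in Bornology.cobounded Plane,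
      1 + (toComplex B - toComplex A) * (toComplex A - toComplex y)⁻¹ = viewRatio A B y := by
    have : ∀ᶠ y in Bornology.cobounded Plane, y ∉ ({A} : Set Plane) :=
      (Bornology.isBounded_singleton (x := A))
    filter_upwards [this] with y hy
    have : toComplex A - toComplex y ≠ 0 := by
      rw [sub_ne_zero]
      exact fun h => hy (toComplex.injective h).symm
    rw [viewRatio]; field_simp; ring
  have h5 := h3.congr' h4
  have h6 : ContinuousAt Complex.arg 1 := Complex.continuousAt_arg (by simp)
  have h7 := h6.tendsto.comp h5
  rw [Complex.arg_one] at h7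
  exact h7

lemma exp_sum_arg_of_prod_eq_one {ι : Type*} (s : Finset ι) (w : ι → ℂ) (h : ∏ i ∈ s, w i = 1) :
    Complex.exp ((∑ i ∈ s, (w i).arg : ℝ) * Complex.I) = 1 := by
  have h1 : ∏ i ∈ s, w i =
      ((∏ i ∈ s, ‖w i‖ : ℝ) : ℂ) * Complex.exp ((∑ i ∈ s, (w i).arg : ℝ) * Complex.I) := by
    push_cast
    rw [Finset.sum_mul, Complex.exp_sum, ← Finset.prod_mul_distrib]
    exact Finset.prod_congr rfl fun i _ => (Complex.norm_mul_exp_arg_mul_I _).symm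
  have h2 : ∏ i ∈ s, ‖w i‖ = 1 := by rw [← norm_prod, h, norm_one]
  rw [h2, h] at h1
  simpa using h1.symm

namespace SimplePolygon

variable (P : SimplePolygon)

/-- The cyclic successor of a corner. -/
abbrev next (i : Fin P.n) : Fin P.n := finRotate P.n i

lemma edgeSet_eq (i : Fin P.n) :
    P.poly.edgeSet ℝ i = segment ℝ (P.poly i) (P.poly (P.next i)) := affineSegment_eq_segment _ _ _

lemma mem_boundary {x : Plane} :
    x ∈ P.boundary ↔ ∃ i, x ∈ segment ℝ (P.poly i) (P.poly (P.next i)) := by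
  simp [boundary, Polygon.boundary, edgeSet_eq]

lemma next_ne (i : Fin P.n) : P.next i ≠ i := by
  have h := P.three_le
  obtain ⟨n, hn⟩ : ∃ n, P.n = n + 2 := ⟨P.n - 2, by omega⟩
  have : ∀ (m : ℕ) (hm : m = n + 2) (i : Fin m), finRotate m i ≠ i := by
    rintro m rfl i
    rw [finRotate_apply]
    simp
  exact this _ hn i

lemma poly_next_ne (i : Fin P.n) : P.poly (P.next i) ≠ P.poly i :=
  fun h => P.next_ne i (P.injective_vertices h)

lemma isClosed_boundary : IsClosed P.boundary := by
  have : P.boundary = ⋃ i, segment ℝ (P.poly i) (P.poly (P.next i)) := by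
    ext x; simp [mem_boundary]
  rw [this]
  exact isClosed_iUnion_of_finite fun i => isClosed_segment_plane _ _

/-- The total oriented angle (`2π` times the winding number) under which the boundary curve appears
from a point. -/
noncomputable def angleSum (x : Plane) : ℝ :=
  ∑ i, (viewRatio (P.poly i) (P.poly (P.next i)) x).arg

lemma exp_angleSum {x : Plane} (hx : ∀ i, P.poly i ≠ x) :
    Complex.exp (P.angleSum x * Complex.I) = 1 := by
  apply exp_sum_arg_of_prod_eq_one
  simp only [viewRatio]
  rw [Finset.prod_div_distrib,
    Equiv.prod_comp (finRotate P.n) (fun i => toComplex (P.poly i) - toComplex x)]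
  apply div_self
  rw [Finset.prod_ne_zero_iff]
  intro i _
  simpa [sub_eq_zero] using hx i

lemma angleSum_mem {x : Plane} (hx : ∀ i, P.poly i ≠ x) :
    P.angleSum x ∈ AddSubgroup.zmultiples (2 * π) := by
  obtain ⟨n, hn⟩ := Complex.exp_eq_one_iff.1 (P.exp_angleSum hx)
  refine ⟨n, ?_⟩
  have : (P.angleSum x : ℂ) = n * (2 * π) := by
    have hI := Complex.I_ne_zero
    apply mul_right_cancel₀ hI
    rw [hn]; ring
  have h2 : P.angleSum x = n * (2 * π) := by exact_mod_cast this
  simp [h2]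

lemma poly_ne_of_notMem_boundary {x : Plane} (hx : x ∉ P.boundary) (i : Fin P.n) :
    P.poly i ≠ x := by
  rintro rfl
  exact hx (P.mem_boundary.2 ⟨i, left_mem_segment _ _ _⟩)

/-- Seen from a point outside the polygon, the boundary curve has winding number zero: the winding
number is constant on components, and it vanishes far away. -/
lemma angleSum_eq_zero {x : Plane} (hx : x ∉ P.boundary) (hx' : x ∉ P.inside) :
    P.angleSum x = 0 := by
  have hub : ¬ Bornology.IsBounded (connectedComponentIn P.boundaryᶜ x) := fun h => hx' ⟨hx, h⟩
  have hsub := connectedComponentIn_subset P.boundaryᶜ x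
  have hcont : ContinuousOn P.angleSum (connectedComponentIn P.boundaryᶜ x) := by
    intro y hy
    apply ContinuousAt.continuousWithinAt
    unfold angleSum
    refine tendsto_finsetSum _ fun i _ => ?_
    exact continuousAt_arg_viewRatio fun h => hsub hy (P.mem_boundary.2 ⟨i, h⟩)
  obtain ⟨c, hc, hcc⟩ := isPreconnected_connectedComponentIn.eqOn_const_of_mapsTo
    (T := (AddSubgroup.zmultiples (2 * π) : Set ℝ))
    ⟨inferInstanceAs (DiscreteTopology (AddSubgroup.zmultiples (2 * π)))⟩ hcont
    (fun y hy => P.angleSum_mem (P.poly_ne_of_notMem_boundary (hsub hy))) ⟨0, zero_mem _⟩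
  have hlim : Filter.Tendsto P.angleSum (Bornology.cobounded Plane) (𝓝 0) := by
    have := tendsto_finsetSum (Finset.univ : Finset (Fin P.n))
      fun i _ => tendsto_arg_viewRatio_cobounded (P.poly i) (P.poly (P.next i))
    rw [Finset.sum_const_zero] at this
    exact this
  have hev : ∀ᶠ y in Bornology.cobounded Plane, |P.angleSum y| < 1 := by
    have := hlim.eventually (Metric.ball_mem_nhds 0 one_pos)
    simpa [Real.dist_eq] using this
  have : ∃ y ∈ connectedComponentIn P.boundaryᶜ x, |P.angleSum y| < 1 := by
    by_contra! hcon
    have hb : Bornology.IsBounded {y | |P.angleSum y| < 1}ᶜ := by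
      rw [Bornology.isBounded_def, compl_compl]; exact hev
    refine hub (hb.subset ?_)
    intro y hy
    simpa using hcon y hy
  obtain ⟨y, hy, hy1⟩ := this
  have hxc : P.angleSum x = c := hcc (mem_connectedComponentIn hx)
  have hyc : P.angleSum y = c := hcc hy
  rw [hyc] at hy1
  obtain ⟨n, rfl⟩ := hc
  rw [hxc]
  have hpi := Real.pi_gt_three
  simp only [zsmul_eq_mul, abs_mul, abs_of_pos Real.two_pi_pos] at hy1 ⊢
  have hn : |(n : ℝ)| < 1 := by
    have := abs_nonneg (n : ℝ)
    nlinarith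
  have hn0 : n = 0 := by
    have : |n| < 1 := by exact_mod_cast hn
    exact Int.abs_lt_one_iff.1 this
  simp [hn0]

end SimplePolygon

lemma viewRatio_im (A B x : Plane) :
    (viewRatio A B x).im = cross (B - A) (x - A) / Complex.normSq (toComplex A - toComplex x) := by
  simp only [viewRatio, Complex.div_im, Complex.sub_re, Complex.sub_im, toComplex_re, toComplex_im,
    cross, PiLp.sub_apply]
  ring

namespace SimplePolygon

variable (P : SimplePolygon)

/-- Each edge of a simple polygon borders its interior: moving away from a relatively interior
point of an edge in two opposite transversal directions, one enters the interior on at least one of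
the two sides, because the winding numbers on the two sides differ. -/
theorem eventually_inside_of_transversal (i : Fin P.n) {r d : Plane}
    (hr : r ∈ openSegment ℝ (P.poly i) (P.poly (P.next i)))
    (hd : cross (P.poly (P.next i) - P.poly i) d ≠ 0) :
    ∀ᶠ ε in 𝓝[>] (0 : ℝ), r + ε • d ∈ P.inside ∨ r + (-ε) • d ∈ P.inside := by
  classical
  set A := P.poly i with hA
  set B := P.poly (P.next i) with hB
  set c := cross (B - A) d with hc
  have hAB : B - A ≠ 0 := sub_ne_zero.2 (P.poly_next_ne i)
  have hrs : r ∈ segment ℝ A B := openSegment_subset_segment _ _ _ hr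
  rw [openSegment_eq_image_lineMap] at hr
  obtain ⟨t, ⟨ht0, ht1⟩, rfl⟩ := hr
  set r := AffineMap.lineMap A B t with hrdef
  have hrA : A - r = (-t) • (B - A) := by
    simp [hrdef, AffineMap.lineMap_apply]
  have hrB : B - r = (1 - t) • (B - A) := by
    simp only [hrdef, AffineMap.lineMap_apply, vsub_eq_sub, vadd_eq_add]; module
  have hrA0 : A ≠ r := by
    rw [← sub_ne_zero, hrA]; exact smul_ne_zero (by linarith) hAB
  have hrB0 : B ≠ r := by
    rw [← sub_ne_zero, hrB]; exact smul_ne_zero (by linarith) hAB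
  have hother : ∀ j, j ≠ i → r ∉ segment ℝ (P.poly j) (P.poly (P.next j)) := by
    intro j hj hrj
    have := (P.edge_inter i j hj.symm ⟨by rwa [P.edgeSet_eq], by rwa [P.edgeSet_eq]⟩).1
    rcases this with h | h
    · exact hrA0 h.symm
    · exact hrB0 h.symm
  have hne : ∀ j, P.poly j ≠ r := by
    intro j
    by_cases hj : j = i
    · subst hj; exact hrA0
    · intro h
      exact hother j hj (h ▸ left_mem_segment _ _ _)
  -- the sum over the other edges is continuous at `r`
  set G : Plane → ℝ := fun x =>
    ∑ j ∈ Finset.univ.erase i, (viewRatio (P.poly j) (P.poly (P.next j)) x).arg with hG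
  have hsplit : ∀ x, P.angleSum x = G x + (viewRatio A B x).arg := by
    intro x
    rw [angleSum, hG, add_comm]
    exact (Finset.add_sum_erase _ _ (Finset.mem_univ i)).symm
  have hGc : ContinuousAt G r := by
    refine tendsto_finsetSum _ fun j hj => ?_
    exact continuousAt_arg_viewRatio (hother j (Finset.ne_of_mem_erase hj))
  -- at `r` itself the edge from `A` to `B` appears under the angle `π`
  have hG0 : G r ≠ 0 := by
    intro h0
    have h1 := P.exp_angleSum hne
    have h2 : viewRatio A B r = ((-((1 - t) / t) : ℝ) : ℂ) := by
      have e1 : toComplex A - toComplex r = ((-t : ℝ) : ℂ) * (toComplex B - toComplex A) := by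
        rw [← map_sub, hrA, LinearIsometryEquiv.map_smul, map_sub, Complex.real_smul]
      have e2 : toComplex B - toComplex r = ((1 - t : ℝ) : ℂ) * (toComplex B - toComplex A) := by
        rw [← map_sub, hrB, LinearIsometryEquiv.map_smul, map_sub, Complex.real_smul]
      have e3 : toComplex B - toComplex A ≠ 0 := by
        rw [← map_sub]; exact (map_ne_zero_iff _ toComplex.injective).2 hAB
      have e4 : (t : ℂ) ≠ 0 := by exact_mod_cast ht0.ne'
      rw [viewRatio, e1, e2]
      push_cast
      field_simp
    have h3 : (viewRatio A B r).arg = π := by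
      rw [h2]
      exact Complex.arg_ofReal_of_neg (neg_lt_zero.2 (div_pos (by linarith) ht0))
    rw [hsplit, h0, h3] at h1
    simp [Complex.exp_pi_mul_I] at h1
    norm_num at h1
  by_contra hcon
  replace hcon := Filter.not_eventually.1 hcon
  have hlim : ∀ s : ℝ, Filter.Tendsto (fun ε : ℝ => r + (s * ε) • d) (𝓝[>] 0) (𝓝 r) := by
    intro s
    exact (tendsto_add_smul r (s • d)).congr fun ε => by rw [smul_smul, mul_comm]
  have hoff : ∀ s : ℝ, s ≠ 0 → ∀ᶠ ε in 𝓝[>] (0 : ℝ), r + (s * ε) • d ∉ P.boundary := by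
    intro s hs
    have h1 : ∀ j, ∀ᶠ ε in 𝓝[>] (0 : ℝ), j ≠ i →
        r + (s * ε) • d ∉ segment ℝ (P.poly j) (P.poly (P.next j)) := by
      intro j
      by_cases hj : j = i
      · simp [hj]
      · have := (hlim s).eventually
          ((isClosed_segment_plane _ _).isOpen_compl.mem_nhds (hother j hj))
        filter_upwards [this] with ε h _ using h
    filter_upwards [Filter.eventually_all.2 h1, self_mem_nhdsWithin] with ε h hε hb
    obtain ⟨j, hj⟩ := P.mem_boundary.1 hb
    by_cases hji : j = i
    · subst hji
      have h3 := cross_eq_zero_of_mem_segment hj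
      have h4 := cross_eq_zero_of_mem_segment hrs
      have : cross (B - A) (r + (s * ε) • d - A) = cross (B - A) (r - A) + s * ε * c := by
        simp only [cross, hc, PiLp.sub_apply, PiLp.add_apply, PiLp.smul_apply, smul_eq_mul]; ring
      rw [← hB, ← hA, this, h4, zero_add] at h3
      exact (mul_ne_zero (mul_ne_zero hs (ne_of_gt hε)) hd) h3
    · exact h j hji hj
  -- off the polygon the angle sum is zero, so `G` is minus the angle of the edge from `A` to `B`,
  -- whose sign is that of `s * c`
  have hsign : ∀ s ε : ℝ, 0 < ε → r + (s * ε) • d ∉ P.boundary → r + (s * ε) • d ∉ P.inside →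
      s * c ≠ 0 → G (r + (s * ε) • d) * (s * c) ≤ 0 := by
    intro s ε hε h1 h2 hsc
    have h3 := P.angleSum_eq_zero h1 h2
    rw [hsplit] at h3
    have h4 : G (r + (s * ε) • d) = -(viewRatio A B (r + (s * ε) • d)).arg := by linarith
    have h5 := viewRatio_im A B (r + (s * ε) • d)
    have h6 : cross (B - A) (r + (s * ε) • d - A) = ε * (s * c) := by
      have h4 := cross_eq_zero_of_mem_segment hrs
      have : cross (B - A) (r + (s * ε) • d - A) = cross (B - A) (r - A) + s * ε * c := by
        simp only [cross, hc, PiLp.sub_apply, PiLp.add_apply, PiLp.smul_apply, smul_eq_mul]; ring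
      rw [this, h4]; ring
    rw [h6] at h5
    have h7 : 0 < Complex.normSq (toComplex A - toComplex (r + (s * ε) • d)) := by
      rw [Complex.normSq_pos, sub_ne_zero]
      exact fun h => P.poly_ne_of_notMem_boundary h1 i (toComplex.injective h)
    rw [h4]
    rcases lt_or_gt_of_ne hsc with hneg | hpos
    · have : (viewRatio A B (r + (s * ε) • d)).arg < 0 := by
        rw [Complex.arg_neg_iff, h5]
        exact div_neg_of_neg_of_pos (mul_neg_of_pos_of_neg hε hneg) h7
      nlinarith
    · have : 0 ≤ (viewRatio A B (r + (s * ε) • d)).arg := by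
        rw [Complex.arg_nonneg_iff, h5]
        positivity
      nlinarith
  have hle : ∀ s : ℝ, s = 1 ∨ s = -1 → G r * (s * c) ≤ 0 := by
    intro s hs
    have hs0 : s ≠ 0 := by rcases hs with rfl | rfl <;> norm_num
    have hl : Filter.Tendsto (fun ε : ℝ => G (r + (s * ε) • d) * (s * c)) (𝓝[>] 0)
        (𝓝 (G r * (s * c))) := (hGc.tendsto.comp (hlim s)).mul_const _
    refine le_of_tendsto_of_frequently hl ?_
    refine (hcon.and_eventually ((hoff s hs0).and self_mem_nhdsWithin)).mono ?_
    rintro ε ⟨h1, h2, h3⟩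
    refine hsign s ε h3 h2 ?_ (mul_ne_zero hs0 hd)
    push Not at h1
    rcases hs with rfl | rfl
    · simpa using h1.1
    · simpa using h1.2
  have h1 := hle 1 (Or.inl rfl)
  have h2 := hle (-1) (Or.inr rfl)
  have : G r * c = 0 := by linarith
  exact mul_ne_zero hG0 hd this

end SimplePolygon

/-! ### The interior of a polygon near a point -/

namespace SimplePolygon

variable (P : SimplePolygon)

lemma isOpen_inside : IsOpen P.inside := by
  rw [isOpen_iff_mem_nhds]
  rintro x ⟨hx, hb⟩
  have ho : IsOpen (connectedComponentIn P.boundaryᶜ x) :=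
    P.isClosed_boundary.isOpen_compl.connectedComponentIn
  filter_upwards [ho.mem_nhds (mem_connectedComponentIn hx)] with y hy
  refine ⟨connectedComponentIn_subset _ _ hy, ?_⟩
  rwa [← connectedComponentIn_eq hy]

variable {P}

lemma inside_of_isPreconnected {s : Set Plane} (hs : IsPreconnected s)
    (hsub : ∀ x ∈ s, x ∉ P.boundary) {x y : Plane} (hx : x ∈ s) (hy : y ∈ s) (hin : x ∈ P.inside) :
    y ∈ P.inside := by
  have hyc := hs.subset_connectedComponentIn hx (F := P.boundaryᶜ) hsub hy
  refine ⟨hsub y hy, ?_⟩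
  rw [← connectedComponentIn_eq hyc]
  exact hin.2

/-- The exterior of a polygon is open. -/
lemma eventually_notMem_inside {x : Plane} (hb : x ∉ P.boundary) (hi : x ∉ P.inside) :
    ∀ᶠ y in 𝓝 x, y ∉ P.inside := by
  obtain ⟨ε, hε, hball⟩ := Metric.mem_nhds_iff.1 (P.isClosed_boundary.isOpen_compl.mem_nhds hb)
  filter_upwards [Metric.ball_mem_nhds x hε] with y hy hyin
  exact hi (inside_of_isPreconnected (convex_ball x ε).isPreconnected hball hy
    (Metric.mem_ball_self hε) hyin)

end SimplePolygon

/-- Near any point `a`, a segment coincides with a cone of apex `a`. -/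
lemma eventually_mem_segment_of_homothety {A B : Plane} (hAB : A ≠ B) (a : Plane) :
    ∀ᶠ y in 𝓝 a, ∀ t ∈ Set.Ioc (0 : ℝ) 1, a + t • (y - a) ∈ segment ℝ A B → y ∈ segment ℝ A B := by
  by_cases ha : a ∈ segment ℝ A B
  · rw [segment_eq_image_lineMap] at ha ⊢
    obtain ⟨τ, ⟨hτ0, hτ1⟩, rfl⟩ := ha
    set D := B - A with hD
    have hD0 : 0 < ‖D‖ := norm_pos_iff.2 (sub_ne_zero.2 hAB.symm)
    -- `m` bounds the distance, in units of `D`, from `a` to the ends of the segment other than `a`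
    obtain ⟨m, hm, hm1, hm2⟩ : ∃ m : ℝ, 0 < m ∧ (τ < 1 → m ≤ 1 - τ) ∧ (0 < τ → m ≤ τ) := by
      rcases hτ0.eq_or_lt with h0 | h0 <;> rcases hτ1.eq_or_lt with h1 | h1
      · exact ⟨1, one_pos, by intro; linarith, by intro; linarith⟩
      · exact ⟨1 - τ, by linarith, fun _ => le_rfl, by intro; linarith⟩
      · exact ⟨τ, by linarith, by intro; linarith, by intro; linarith⟩
      · exact ⟨min (1 - τ) τ, lt_min (by linarith) h0, fun _ => min_le_left _ _,
          fun _ => min_le_right _ _⟩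
    filter_upwards [Metric.ball_mem_nhds _ (mul_pos hm hD0)]
      with y hy t ⟨ht0, ht1⟩ ⟨τ', ⟨h0, h1⟩, he⟩
    rw [Metric.mem_ball, dist_eq_norm] at hy
    set a := AffineMap.lineMap A B τ with haτ
    have hya : y - a = ((τ' - τ) / t) • D := by
      have : t • (y - a) = (τ' - τ) • D := by
        have h2 : t • (y - a) = AffineMap.lineMap A B τ' - a := by rw [he]; abel
        rw [h2, haτ]
        simp only [AffineMap.lineMap_apply, vsub_eq_sub, vadd_eq_add, hD]; module
      rw [div_eq_inv_mul, mul_smul, ← this, smul_smul, inv_mul_cancel₀ ht0.ne', one_smul]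
    set κ := (τ' - τ) / t with hκ
    rw [hya, norm_smul, Real.norm_eq_abs] at hy
    have hκm := lt_of_mul_lt_mul_right hy hD0.le
    have hκt : κ * t = τ' - τ := by rw [hκ]; field_simp
    refine ⟨τ + κ, ⟨?_, ?_⟩, ?_⟩
    · rcases lt_or_ge κ 0 with hk | hk
      · have : 0 < τ := by nlinarith
        have := hm2 this
        rw [abs_of_neg hk] at hκm; linarith
      · linarith
    · rcases lt_or_ge 0 κ with hk | hk
      · have : τ < 1 := by nlinarith
        have := hm1 this
        rw [abs_of_pos hk] at hκm; linarith
      · linarith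
    · have : y = a + κ • D := by rw [← hya]; abel
      rw [this, haτ]
      simp only [AffineMap.lineMap_apply, vsub_eq_sub, vadd_eq_add, hD]; module
  · obtain ⟨ε, hε, hball⟩ := Metric.mem_nhds_iff.1
      ((isClosed_segment_plane A B).isOpen_compl.mem_nhds ha)
    filter_upwards [Metric.ball_mem_nhds a hε] with y hy t ⟨ht0, ht1⟩ hmem
    refine absurd hmem (hball ?_)
    exact (convex_ball a ε).add_smul_sub_mem (Metric.mem_ball_self hε) hy ⟨ht0.le, ht1⟩

namespace SimplePolygon

variable {P : SimplePolygon}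

/-- Near any point `a`, the interior of a polygon coincides with a cone of apex `a`. -/
lemma eventually_homothety_inside (a : Plane) :
    ∀ᶠ y in 𝓝 a, y ∈ P.inside → ∀ t ∈ Set.Ioc (0 : ℝ) 1, a + t • (y - a) ∈ P.inside := by
  have h := Filter.eventually_all.2 fun i : Fin P.n =>
    eventually_mem_segment_of_homothety (P.poly_next_ne i).symm a
  filter_upwards [h] with y hy hin t ht
  have hpre : IsPreconnected ((fun t : ℝ => a + t • (y - a)) '' Set.Ioc (0 : ℝ) 1) :=
    isPreconnected_Ioc.image _ (by fun_prop)
  refine inside_of_isPreconnected hpre ?_ (x := y) ⟨1, by simp, by simp⟩ ⟨t, ht, rfl⟩ hin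
  rintro _ ⟨s, hs, rfl⟩ hb
  obtain ⟨i, hi⟩ := P.mem_boundary.1 hb
  exact hin.1 (P.mem_boundary.2 ⟨i, hy i s hs hi⟩)

end SimplePolygon

/-! ### Free directions -/

lemma isFreeDirection_iff {S : Finset SimplePolygon} {u x : Plane} :
    IsFreeDirection S u x ↔ ∀ P ∈ S, ∀ᶠ t in 𝓝[>] (0 : ℝ), u + t • (x - u) ∉ P.inside := by
  simp [IsFreeDirection, AffineMap.lineMap_apply, add_comm]

lemma IsFreeDirection.smul {S : Finset SimplePolygon} {u x y : Plane} {k : ℝ} (hk : 0 < k)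
    (h : IsFreeDirection S u x) (hy : y - u = k • (x - u)) : IsFreeDirection S u y := by
  rw [isFreeDirection_iff] at h ⊢
  intro P hP
  have ht : Filter.Tendsto (fun t : ℝ => t * k) (𝓝[>] 0) (𝓝[>] 0) := by
    refine tendsto_nhdsWithin_iff.2 ⟨?_, ?_⟩
    · have : ContinuousAt (fun t : ℝ => t * k) 0 := by fun_prop
      have := this.tendsto
      rw [zero_mul] at this
      exact this.mono_left nhdsWithin_le_nhds
    · filter_upwards [self_mem_nhdsWithin] with t ht using mul_pos ht hk
  filter_upwards [ht.eventually (h P hP)] with t ht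
  rwa [hy, smul_smul]

/-- Along an edge of an obstacle, next to the direction of the edge, there are directions that are
not free: near each point `a` of the edge the interior is a cone of apex `a`, and it borders the
edge. -/
theorem SimplePolygon.exists_not_isFreeDirection {S : Finset SimplePolygon} {P : SimplePolygon}
    (hP : P ∈ S) {i : Fin P.n} {a z : Plane}
    (ha : a ∈ segment ℝ (P.poly i) (P.poly (P.next i)))
    (hz : z ∈ segment ℝ (P.poly i) (P.poly (P.next i))) (hza : z ≠ a) {O : Set Plane}
    (hO : O ∈ 𝓝 z) : ∃ y ∈ O, ¬ IsFreeDirection S a y := by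
  set A := P.poly i
  set B := P.poly (P.next i)
  have hAB : B - A ≠ 0 := sub_ne_zero.2 (P.poly_next_ne i)
  obtain ⟨τ, hconic, hτ0, hτ1⟩ : ∃ τ : ℝ, (∀ᶠ y in 𝓝 (a + τ • (z - a)),
      y ∈ P.inside → ∀ t ∈ Set.Ioc (0 : ℝ) 1, a + t • (y - a) ∈ P.inside) ∧ 0 < τ ∧ τ < 1 := by
    have h1 := (P.eventually_homothety_inside a).eventually_nhds
    obtain ⟨τ, h3, h4⟩ := (((tendsto_add_smul a (z - a)).eventually h1).and
      (Ioo_mem_nhdsGT one_pos)).exists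
    exact ⟨τ, h3, h4.1, h4.2⟩
  have hr : a + τ • (z - a) ∈ openSegment ℝ A B := by
    rw [segment_eq_image_lineMap] at ha hz
    obtain ⟨α, ⟨hα0, hα1⟩, rfl⟩ := ha
    obtain ⟨ζ, ⟨hζ0, hζ1⟩, rfl⟩ := hz
    have hne : ζ ≠ α := by rintro rfl; exact hza rfl
    rw [openSegment_eq_image_lineMap]
    refine ⟨α + τ * (ζ - α), ⟨?_, ?_⟩, ?_⟩
    · rcases lt_or_gt_of_ne hne with h | h <;> nlinarith
    · rcases lt_or_gt_of_ne hne with h | h <;> nlinarith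
    · simp only [AffineMap.lineMap_apply, vsub_eq_sub, vadd_eq_add]; module
  set d : Plane := !₂[-((B - A) 1), (B - A) 0] with hd
  have hcross : cross (B - A) d ≠ 0 := by
    have : cross (B - A) d = (B - A) 0 ^ 2 + (B - A) 1 ^ 2 := by simp [cross, hd]; ring
    rw [this]
    intro h
    apply hAB
    ext j
    fin_cases j
    · simp only [PiLp.sub_apply, Fin.zero_eta, PiLp.zero_apply] at h ⊢
      nlinarith [sq_nonneg (B 0 - A 0), sq_nonneg (B 1 - A 1)]
    · simp only [PiLp.sub_apply, Fin.mk_one, PiLp.zero_apply] at h ⊢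
      nlinarith [sq_nonneg (B 0 - A 0), sq_nonneg (B 1 - A 1)]
  have hin := P.eventually_inside_of_transversal i hr hcross
  have hnear : ∀ s : ℝ, ∀ᶠ ε in 𝓝[>] (0 : ℝ),
      (a + τ • (z - a) + (s * ε) • d ∈ P.inside → ∀ t ∈ Set.Ioc (0 : ℝ) 1,
        a + t • (a + τ • (z - a) + (s * ε) • d - a) ∈ P.inside) ∧ z + (s * ε / τ) • d ∈ O := by
    intro s
    have h1 : Filter.Tendsto (fun ε : ℝ => a + τ • (z - a) + (s * ε) • d) (𝓝[>] 0)
        (𝓝 (a + τ • (z - a))) :=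
      (tendsto_add_smul _ (s • d)).congr fun ε => by rw [smul_smul, mul_comm]
    have h2 : Filter.Tendsto (fun ε : ℝ => z + (s * ε / τ) • d) (𝓝[>] 0) (𝓝 z) :=
      (tendsto_add_smul z ((s / τ) • d)).congr fun ε => by rw [smul_smul]; ring_nf
    exact (h1.eventually hconic).and (h2.eventually hO)
  obtain ⟨ε, ⟨h1, h2, h3⟩, -⟩ :=
    (((hin.and ((hnear 1).and (hnear (-1)))).and self_mem_nhdsWithin).exists)
  obtain ⟨s, h4, h5, h6⟩ : ∃ s : ℝ, a + τ • (z - a) + (s * ε) • d ∈ P.inside ∧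
      (∀ t ∈ Set.Ioc (0 : ℝ) 1,
        a + t • (a + τ • (z - a) + (s * ε) • d - a) ∈ P.inside) ∧ z + (s * ε / τ) • d ∈ O := by
    rcases h1 with h | h
    · rw [← one_mul ε] at h
      exact ⟨1, h, h2.1 h, h2.2⟩
    · rw [neg_eq_neg_one_mul] at h
      exact ⟨-1, h, h3.1 h, h3.2⟩
  refine ⟨_, h6, fun hfree => ?_⟩
  have h7 := (isFreeDirection_iff.1 hfree P hP).and (Ioo_mem_nhdsGT hτ0)
  obtain ⟨t, ht1, ht0, htτ⟩ := h7.exists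
  apply ht1
  have h8 := h5 (t / τ) ⟨by positivity, by rw [div_le_one hτ0]; exact htτ.le⟩
  convert h8 using 2
  have : t • (z + (s * ε / τ) • d - a) = (t / τ) • (τ • (z - a) + (s * ε) • d) := by
    rw [show z + (s * ε / τ) • d - a = (z - a) + (s * ε / τ) • d by abel, smul_add, smul_add,
      smul_smul, smul_smul, smul_smul, div_mul_cancel₀ _ hτ0.ne']
    congr 2
    ring
  rw [this]
  congr 1
  abel

/-! ### Triangles -/

/-- The closed triangle with corners `a`, `b`, `c`. -/
def triangle (a b c : Plane) : Set Plane :=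
  {q | ∃ β γ : ℝ, 0 ≤ β ∧ 0 ≤ γ ∧ β + γ ≤ 1 ∧ q = a + β • (b - a) + γ • (c - a)}

/-- The barycentric coordinate with respect to `b` in the triangle `a`, `b`, `c`. -/
noncomputable def baryB (a b c q : Plane) : ℝ := cross (q - a) (c - a) / cross (b - a) (c - a)

/-- The barycentric coordinate with respect to `c` in the triangle `a`, `b`, `c`. -/
noncomputable def baryC (a b c q : Plane) : ℝ := cross (b - a) (q - a) / cross (b - a) (c - a)

section bary

variable {a b c : Plane}

lemma eq_bary (h : cross (b - a) (c - a) ≠ 0) (q : Plane) :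
    q = a + baryB a b c q • (b - a) + baryC a b c q • (c - a) := by
  ext j
  simp only [PiLp.add_apply, PiLp.smul_apply, smul_eq_mul, baryB, baryC]
  rw [div_mul_eq_mul_div, div_mul_eq_mul_div, add_assoc, ← add_div, ← sub_eq_iff_eq_add',
    eq_div_iff h]
  simp only [cross, PiLp.sub_apply]
  fin_cases j <;> simp <;> ring

lemma baryB_eq (h : cross (b - a) (c - a) ≠ 0) (β γ : ℝ) :
    baryB a b c (a + β • (b - a) + γ • (c - a)) = β := by
  rw [baryB, div_eq_iff h]
  simp only [cross, PiLp.sub_apply, PiLp.add_apply, PiLp.smul_apply, smul_eq_mul]; ring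

lemma baryC_eq (h : cross (b - a) (c - a) ≠ 0) (β γ : ℝ) :
    baryC a b c (a + β • (b - a) + γ • (c - a)) = γ := by
  rw [baryC, div_eq_iff h]
  simp only [cross, PiLp.sub_apply, PiLp.add_apply, PiLp.smul_apply, smul_eq_mul]; ring

lemma mem_triangle_iff (h : cross (b - a) (c - a) ≠ 0) {q : Plane} :
    q ∈ triangle a b c ↔ 0 ≤ baryB a b c q ∧ 0 ≤ baryC a b c q ∧
      baryB a b c q + baryC a b c q ≤ 1 := by
  constructor
  · rintro ⟨β, γ, h1, h2, h3, rfl⟩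
    rw [baryB_eq h, baryC_eq h]
    exact ⟨h1, h2, h3⟩
  · rintro ⟨h1, h2, h3⟩
    exact ⟨_, _, h1, h2, h3, eq_bary h q⟩

lemma continuous_cross {f g : Plane → Plane} (hf : Continuous f) (hg : Continuous g) :
    Continuous fun q => cross (f q) (g q) := by
  unfold cross
  fun_prop

lemma continuous_baryB : Continuous (baryB a b c) :=
  (continuous_cross (by fun_prop) (by fun_prop)).div_const _

lemma continuous_baryC : Continuous (baryC a b c) :=
  (continuous_cross (by fun_prop) (by fun_prop)).div_const _

lemma baryB_line (x y : Plane) (t : ℝ) : baryB a b c (x + t • (y - x)) =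
    baryB a b c x + t * (baryB a b c y - baryB a b c x) := by
  simp only [baryB, cross, PiLp.sub_apply, PiLp.add_apply, PiLp.smul_apply, smul_eq_mul]; ring

lemma baryC_line (x y : Plane) (t : ℝ) : baryC a b c (x + t • (y - x)) =
    baryC a b c x + t * (baryC a b c y - baryC a b c x) := by
  simp only [baryC, cross, PiLp.sub_apply, PiLp.add_apply, PiLp.smul_apply, smul_eq_mul]; ring

end bary

lemma left_mem_triangle (a b c : Plane) : a ∈ triangle a b c := ⟨0, 0, by simp⟩

lemma mid_mem_triangle (a b c : Plane) : b ∈ triangle a b c := ⟨1, 0, by simp⟩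

lemma right_mem_triangle (a b c : Plane) : c ∈ triangle a b c := ⟨0, 1, by simp⟩

lemma convex_triangle (a b c : Plane) : Convex ℝ (triangle a b c) := by
  rintro x ⟨β, γ, h1, h2, h3, rfl⟩ y ⟨β', γ', h1', h2', h3', rfl⟩ s t hs ht hst
  refine ⟨s * β + t * β', s * γ + t * γ', by positivity, by positivity, by nlinarith, ?_⟩
  have : s = 1 - t := by linarith
  subst this
  module

lemma Visible.symm {S : Finset SimplePolygon} {u v : Plane} (h : Visible S u v) :
    Visible S v u := by
  intro P hP
  rw [segment_symm]
  exact h P hP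

lemma visible_of_disjoint_triangle {S : Finset SimplePolygon} {a b c x y : Plane}
    (h : ∀ P ∈ S, Disjoint (triangle a b c) P.inside) (hx : x ∈ triangle a b c)
    (hy : y ∈ triangle a b c) : Visible S x y := fun P hP =>
  (h P hP).mono_left ((convex_triangle a b c).segment_subset hx hy)

lemma Visible.isFreeDirection {S : Finset SimplePolygon} {x y : Plane} (h : Visible S x y) :
    IsFreeDirection S x y := by
  rw [isFreeDirection_iff]
  intro P hP
  filter_upwards [Ioo_mem_nhdsGT one_pos] with t ht hin
  refine Set.disjoint_left.1 (h P hP) ?_ hin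
  rw [segment_eq_image']
  exact ⟨t, ⟨ht.1.le, ht.2.le⟩, rfl⟩

/-! ### Obstacle-free triangles -/

section emptyTriangle

variable {V : Finset Plane} {S : Finset SimplePolygon} {a b c : Plane}

lemma isFreeDirection_of_bary_pos (h : cross (b - a) (c - a) ≠ 0)
    (hfree : ∀ z ∈ openSegment ℝ b c, IsFreeDirection S a z) {y : Plane}
    (hb : 0 < baryB a b c y) (hc : 0 < baryC a b c y) : IsFreeDirection S a y := by
  set β := baryB a b c y
  set γ := baryC a b c y
  have hy : y = a + β • (b - a) + γ • (c - a) := eq_bary h y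
  refine (hfree ((β / (β + γ)) • b + (γ / (β + γ)) • c) ?_).smul (k := β + γ) (by positivity) ?_
  · exact ⟨_, _, by positivity, by positivity, by field_simp, rfl⟩
  · have e : (β + γ) • ((β / (β + γ)) • b + (γ / (β + γ)) • c - a) =
        β • b + γ • c - (β + γ) • a := by
      rw [smul_sub, smul_add, smul_smul, smul_smul]
      congr 3 <;> field_simp
    rw [e, hy]; module

lemma bary_pos_mem_nhds {z : Plane}
    (hb : 0 < baryB a b c z) (hc : 0 < baryC a b c z) :
    {y | 0 < baryB a b c y ∧ 0 < baryC a b c y} ∈ 𝓝 z :=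
  ((isOpen_lt continuous_const continuous_baryB).inter
    (isOpen_lt continuous_const continuous_baryC)).mem_nhds ⟨hb, hc⟩

lemma not_apex_mem_edge (h : cross (b - a) (c - a) ≠ 0)
    (hfree : ∀ z ∈ openSegment ℝ b c, IsFreeDirection S a z) {P : SimplePolygon} (hP : P ∈ S)
    {i : Fin P.n} {z : Plane} (hz : z ∈ segment ℝ (P.poly i) (P.poly (P.next i)))
    (hb : 0 < baryB a b c z) (hc : 0 < baryC a b c z) :
    a ∉ segment ℝ (P.poly i) (P.poly (P.next i)) := by
  intro ha
  have hza : z ≠ a := by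
    rintro rfl
    simp [baryB, cross] at hb
  obtain ⟨y, hy, hyf⟩ := SimplePolygon.exists_not_isFreeDirection hP ha hz hza
    (bary_pos_mem_nhds hb hc)
  exact hyf (isFreeDirection_of_bary_pos h hfree hy.1 hy.2)

/-- A visible segment is not crossed by an edge of an obstacle. -/
lemma Visible.not_crossed {P : SimplePolygon} (hP : P ∈ S) {u v : Plane} (huv : Visible S u v)
    {i : Fin P.n} {r : Plane} (hr : r ∈ openSegment ℝ (P.poly i) (P.poly (P.next i)))
    (hruv : r ∈ openSegment ℝ u v) : cross (P.poly (P.next i) - P.poly i) (v - u) = 0 := by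
  by_contra hd
  have hin := P.eventually_inside_of_transversal i hr hd
  rw [openSegment_eq_image'] at hruv
  obtain ⟨g, ⟨hg0, hg1⟩, rfl⟩ := hruv
  obtain ⟨ε, h1, h2, h3⟩ := (hin.and (Ioo_mem_nhdsGT (lt_min hg0 (sub_pos.2 hg1)))).exists
  have h4 := h3.trans_le (min_le_left _ _)
  have h5 := h3.trans_le (min_le_right _ _)
  have key : ∀ s : ℝ, -g ≤ s → s ≤ 1 - g → u + g • (v - u) + s • (v - u) ∉ P.inside := by
    intro s hs1 hs2 hin
    refine Set.disjoint_left.1 (huv P hP) ?_ hin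
    rw [segment_eq_image']
    exact ⟨g + s, ⟨by linarith, by linarith⟩, by simp only; module⟩
  rcases h1 with h | h
  · exact key ε (by linarith) h5.le h
  · exact key (-ε) (by linarith) (by linarith) h

/-- Let an edge of an obstacle pass through an inner point `z` of the triangle, and follow it to an
endpoint `e` such that the distance to the side `bc` does not shrink on the way. It would have to
end in the apex, or to leave the triangle through one of the two visible sides. -/
lemma edge_avoids_triangle_aux (h : cross (b - a) (c - a) ≠ 0) (hab : Visible S a b)
    (hac : Visible S a c) (hfree : ∀ z ∈ openSegment ℝ b c, IsFreeDirection S a z)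
    {P : SimplePolygon} (hP : P ∈ S) {i : Fin P.n} {z e : Plane}
    (hz : z ∈ segment ℝ (P.poly i) (P.poly (P.next i)))
    (he : e = P.poly i ∨ e = P.poly (P.next i))
    (hV : e ∈ triangle a b c → e = a ∨ e ∈ segment ℝ b c)
    (hb : 0 < baryB a b c z) (hc : 0 < baryC a b c z) (hbc : baryB a b c z + baryC a b c z < 1)
    (hmono : baryB a b c e + baryC a b c e ≤ baryB a b c z + baryC a b c z) : False := by
  have hes : e ∈ segment ℝ (P.poly i) (P.poly (P.next i)) := by
    rcases he with rfl | rfl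
    · exact left_mem_segment _ _ _
    · exact right_mem_segment _ _ _
  have hna := not_apex_mem_edge h hfree hP hz hb hc
  by_cases hneg : 0 ≤ baryB a b c e ∧ 0 ≤ baryC a b c e
  · rcases hV ((mem_triangle_iff h).2 ⟨hneg.1, hneg.2, by linarith⟩) with rfl | hseg
    · exact hna hes
    · rw [segment_eq_image'] at hseg
      obtain ⟨t, -, ht⟩ := hseg
      have : e = a + (1 - t) • (b - a) + t • (c - a) := by rw [← ht]; simp only; module
      rw [this, baryB_eq h, baryC_eq h] at hmono
      linarith
  -- the first point at which the edge leaves the triangle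
  obtain ⟨τ, ⟨hτ0, hτ1⟩, hτ⟩ : ∃ τ ∈ Set.Ioo (0 : ℝ) 1,
      min (baryB a b c (z + τ • (e - z))) (baryC a b c (z + τ • (e - z))) = 0 := by
    have hcont : Continuous fun τ : ℝ =>
        min (baryB a b c (z + τ • (e - z))) (baryC a b c (z + τ • (e - z))) :=
      (continuous_baryB.comp (by fun_prop)).min (continuous_baryC.comp (by fun_prop))
    have := intermediate_value_Ioo' (zero_le_one' ℝ) hcont.continuousOn
    refine this ⟨?_, ?_⟩
    · simp only [one_smul, add_sub_cancel]
      rw [min_lt_iff]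
      by_contra hcon
      push Not at hcon
      exact hneg hcon
    · simp only [zero_smul, add_zero]
      exact lt_min hb hc
  set r := z + τ • (e - z) with hr
  have hrB := baryB_line (a := a) (b := b) (c := c) z e τ
  have hrC := baryC_line (a := a) (b := b) (c := c) z e τ
  rw [← hr] at hrB hrC
  have hr1 : baryB a b c r + baryC a b c r < 1 := by nlinarith
  have hez : e ≠ z := by
    rintro rfl
    exact hneg ⟨hb.le, hc.le⟩
  -- `r` is a relatively interior point of the edge, whose direction is that of `r - z`
  obtain ⟨κ, hκ, hro⟩ : ∃ κ : ℝ, r - z = κ • (P.poly (P.next i) - P.poly i) ∧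
      r ∈ openSegment ℝ (P.poly i) (P.poly (P.next i)) := by
    rw [segment_eq_image'] at hz
    obtain ⟨ζ, ⟨hζ0, hζ1⟩, hζ⟩ := hz
    simp only at hζ
    rw [openSegment_eq_image']
    rcases he with he | he
    · have hζ' : ζ ≠ 0 := by rintro rfl; apply hez; rw [he, ← hζ]; simp
      have hζ'' : 0 < ζ := lt_of_le_of_ne hζ0 hζ'.symm
      refine ⟨-(τ * ζ), ?_, (1 - τ) * ζ, ⟨by nlinarith, by nlinarith⟩, ?_⟩
      · rw [hr, he, ← hζ]; module
      · rw [hr, he, ← hζ]; module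
    · have hζ' : ζ ≠ 1 := by rintro rfl; apply hez; rw [he, ← hζ]; module
      have hζ'' : ζ < 1 := lt_of_le_of_ne hζ1 hζ'
      refine ⟨τ * (1 - ζ), ?_, ζ + τ * (1 - ζ), ⟨by nlinarith, by nlinarith⟩, ?_⟩
      · rw [hr, he, ← hζ]; module
      · rw [hr, he, ← hζ]; module
  have hra : r ≠ a := fun hra => hna (hra ▸ openSegment_subset_segment _ _ _ hro)
  have hreq := eq_bary h r
  rcases min_choice (baryB a b c r) (baryC a b c r) with hm | hm <;> rw [hm] at hτ
  · have hC0 : 0 ≤ baryC a b c r := by rw [← hτ, ← hm]; exact min_le_right _ _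
    have hC1 : baryC a b c r ≠ 0 := by
      intro h0; apply hra; rw [hreq, h0, hτ]; simp
    have hrac : r ∈ openSegment ℝ a c := by
      rw [openSegment_eq_image']
      refine ⟨baryC a b c r, ⟨lt_of_le_of_ne hC0 hC1.symm, by linarith⟩, ?_⟩
      conv_rhs => rw [hreq, hτ]
      simp
    have h0 := hac.not_crossed hP hro hrac
    have h2 : cross (r - z) (c - a) = 0 := by
      rw [hκ]
      simp only [cross, PiLp.sub_apply, PiLp.smul_apply, smul_eq_mul] at h0 ⊢
      linear_combination κ * h0
    have h3 : baryB a b c z = baryB a b c r := by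
      simp only [baryB]
      congr 1
      simp only [cross, PiLp.sub_apply] at h2 ⊢
      linear_combination -h2
    linarith
  · have hB0 : 0 ≤ baryB a b c r := by rw [← hτ, ← hm]; exact min_le_left _ _
    have hB1 : baryB a b c r ≠ 0 := by
      intro h0; apply hra; rw [hreq, h0, hτ]; simp
    have hrab : r ∈ openSegment ℝ a b := by
      rw [openSegment_eq_image']
      refine ⟨baryB a b c r, ⟨lt_of_le_of_ne hB0 hB1.symm, by linarith⟩, ?_⟩
      conv_rhs => rw [hreq, hτ]
      simp
    have h0 := hab.not_crossed hP hro hrab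
    have h2 : cross (r - z) (b - a) = 0 := by
      rw [hκ]
      simp only [cross, PiLp.sub_apply, PiLp.smul_apply, smul_eq_mul] at h0 ⊢
      linear_combination κ * h0
    have h3 : baryC a b c z = baryC a b c r := by
      simp only [baryC]
      congr 1
      simp only [cross, PiLp.sub_apply] at h2 ⊢
      linear_combination h2
    linarith

/-- If two sides of a triangle are visible, no obstacle starts at their common corner into the
triangle, and all corners of obstacles in the triangle lie on the third side or at the apex, then
no obstacle meets the triangle. -/
theorem disjoint_triangle_inside (hS : ∀ P ∈ S, P.corners ⊆ (V : Set Plane))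
    (h : cross (b - a) (c - a) ≠ 0) (hab : Visible S a b)
    (hac : Visible S a c) (hfree : ∀ z ∈ openSegment ℝ b c, IsFreeDirection S a z)
    (hV : ∀ q ∈ V, q ∈ triangle a b c → q = a ∨ q ∈ segment ℝ b c) :
    ∀ P ∈ S, Disjoint (triangle a b c) P.inside := by
  intro P hP
  have hcorner : ∀ i, P.poly i ∈ V := fun i => hS P hP ⟨i, rfl⟩
  set I : Set Plane := {q | 0 < baryB a b c q ∧ 0 < baryC a b c q ∧
    baryB a b c q + baryC a b c q < 1} with hI
  have hIline : ∀ x ∈ triangle a b c, ∀ y ∈ I, ∀ t : ℝ, 0 < t → t ≤ 1 → x + t • (y - x) ∈ I := by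
    intro x hx y hy t ht0 ht1
    rw [mem_triangle_iff h] at hx
    obtain ⟨h1, h2, h3⟩ := hx
    obtain ⟨h4, h5, h6⟩ := hy
    simp only [hI, Set.mem_ofPred_eq, baryB_line, baryC_line]
    refine ⟨?_, ?_, ?_⟩ <;> nlinarith
  have hItri : I ⊆ triangle a b c := fun y hy =>
    (mem_triangle_iff h).2 ⟨hy.1.le, hy.2.1.le, hy.2.2.le⟩
  have hIconv : Convex ℝ I := by
    intro x hx y hy s t hs ht hst
    rcases ht.eq_or_lt with rfl | ht
    · have : s = 1 := by linarith
      subst this; simpa using hx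
    · have := hIline x (hItri hx) y hy t ht (by linarith)
      convert this using 1
      have : s = 1 - t := by linarith
      subst this; module
  have hIb : ∀ z ∈ I, z ∉ P.boundary := by
    rintro z ⟨h1, h2, h3⟩ hz
    obtain ⟨i, hi⟩ := P.mem_boundary.1 hz
    have hi' := hi
    rw [segment_eq_image'] at hi'
    obtain ⟨ζ, ⟨hζ0, hζ1⟩, hζ⟩ := hi'
    simp only at hζ
    have hB := baryB_line (a := a) (b := b) (c := c) (P.poly i) (P.poly (P.next i)) ζ
    have hC := baryC_line (a := a) (b := b) (c := c) (P.poly i) (P.poly (P.next i)) ζ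
    rw [hζ] at hB hC
    rcases le_total (baryB a b c (P.poly i) + baryC a b c (P.poly i))
      (baryB a b c (P.poly (P.next i)) + baryC a b c (P.poly (P.next i))) with hle | hle
    · exact edge_avoids_triangle_aux h hab hac hfree hP hi (Or.inl rfl) (hV _ (hcorner _))
        h1 h2 h3 (by nlinarith)
    · exact edge_avoids_triangle_aux h hab hac hfree hP hi (Or.inr rfl) (hV _ (hcorner _))
        h1 h2 h3 (by nlinarith)
  have hIin : ∀ z ∈ I, z ∉ P.inside := by
    intro z hz hzin
    have hm : (2⁻¹ : ℝ) • b + (2⁻¹ : ℝ) • c ∈ openSegment ℝ b c :=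
      ⟨2⁻¹, 2⁻¹, by norm_num, by norm_num, by norm_num, rfl⟩
    obtain ⟨t, ht, ht0, ht1⟩ := ((isFreeDirection_iff.1 (hfree _ hm) P hP).and
      (Ioo_mem_nhdsGT one_pos)).exists
    refine ht (SimplePolygon.inside_of_isPreconnected hIconv.isPreconnected hIb hz ?_ hzin)
    have : a + t • ((2⁻¹ : ℝ) • b + (2⁻¹ : ℝ) • c - a) =
        a + (t * 2⁻¹) • (b - a) + (t * 2⁻¹) • (c - a) := by module
    rw [this, hI, Set.mem_ofPred_eq, baryB_eq h, baryC_eq h]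
    refine ⟨?_, ?_, ?_⟩ <;> linarith
  rw [Set.disjoint_left]
  intro q hq hqin
  have hg : a + (3⁻¹ : ℝ) • (b - a) + (3⁻¹ : ℝ) • (c - a) ∈ I := by
    rw [hI, Set.mem_ofPred_eq, baryB_eq h, baryC_eq h]; norm_num
  set g := a + (3⁻¹ : ℝ) • (b - a) + (3⁻¹ : ℝ) • (c - a)
  obtain ⟨t, ht, ht0, ht1⟩ := (((tendsto_add_smul q (g - q)).eventually
    (P.isOpen_inside.mem_nhds hqin)).and (Ioo_mem_nhdsGT one_pos)).exists
  exact hIin _ (hIline q hq g hg t ht0 ht1.le) ht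

/-- Let `b` and `d` be visible from `a`, with no obstacle starting at `a` between them. Among the
points of `V` in the triangle `a`, `b`, `d`, the point `p` seen from `b` in the direction closest to
that of `a` cuts off a triangle `a`, `b`, `c` that meets no obstacle. -/
theorem exists_first_point (hS : ∀ P ∈ S, P.corners ⊆ (V : Set Plane)) {d : Plane}
    (h : cross (b - a) (d - a) ≠ 0) (hab : Visible S a b) (had : Visible S a d)
    (hfree : ∀ z ∈ segment ℝ b d, IsFreeDirection S a z) (hdV : d ∈ V)
    (hside : ∀ q ∈ V, q ∈ segment ℝ a b → q = a ∨ q = b) :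
    ∃ p ∈ V, p ≠ a ∧ p ≠ b ∧ p ∈ triangle a b d ∧
      ∃ s : ℝ, 0 < s ∧ s ≤ 1 ∧ p ∈ segment ℝ b (a + s • (d - a)) ∧
        (∀ P ∈ S, Disjoint (triangle a b (a + s • (d - a))) P.inside) ∧
        ∀ q ∈ V, q ≠ a → q ∈ triangle a b d →
          cross (p - b) (q - b) * cross (b - a) (d - a) ≤ 0 := by
  classical
  set W := V.filter fun q => q ∈ triangle a b d ∧ q ≠ a ∧ q ≠ b with hW
  -- the ray from `b` through `q` meets `ad` at `a + s q • (d - a)`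
  set s : Plane → ℝ := fun q => baryC a b d q / (1 - baryB a b d q) with hs
  have hda : d ≠ a := by rintro rfl; simp [cross] at h
  have hdb : d ≠ b := by rintro rfl; apply h; simp only [cross]; ring
  have hWne : W.Nonempty :=
    ⟨d, by rw [hW, Finset.mem_filter]; exact ⟨hdV, right_mem_triangle _ _ _, hda, hdb⟩⟩
  obtain ⟨p, hpW, hpmin⟩ := W.exists_min_image s hWne
  have hWfact : ∀ q ∈ W, baryB a b d q < 1 ∧ 0 < baryC a b d q ∧
      baryB a b d q + baryC a b d q ≤ 1 := by
    intro q hq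
    rw [hW, Finset.mem_filter] at hq
    obtain ⟨hqV, hqt, hqa, hqb⟩ := hq
    rw [mem_triangle_iff h] at hqt
    obtain ⟨h1, h2, h3⟩ := hqt
    have hqe := eq_bary h q
    have hC : 0 < baryC a b d q := by
      refine lt_of_le_of_ne h2 fun h0 => ?_
      rw [← h0, zero_smul, add_zero] at hqe
      have : q ∈ segment ℝ a b := by
        rw [segment_eq_image']
        exact ⟨baryB a b d q, ⟨h1, by linarith⟩, hqe.symm⟩
      rcases hside q hqV this with h' | h'
      · exact hqa h'
      · exact hqb h'
    exact ⟨by linarith, hC, h3⟩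
  have hbV : ∀ q ∈ W, q - b = (1 - baryB a b d q) • ((a - b) + s q • (d - a)) := by
    intro q hq
    have h1 := (hWfact q hq).1
    have h2 : (1 - baryB a b d q) * s q = baryC a b d q := by
      simp only [hs]; field_simp [(sub_pos.2 h1).ne']
    conv_lhs => rw [eq_bary h q]
    rw [smul_add, smul_smul, h2]
    module
  obtain ⟨hp1, hp2, hp3⟩ := hWfact p hpW
  have hps : 0 < s p := div_pos hp2 (by linarith)
  have hps1 : s p ≤ 1 := by
    simp only [hs]; rw [div_le_one (by linarith)]; linarith
  have hpe := hbV p hpW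
  have hpW' := hpW
  rw [hW, Finset.mem_filter] at hpW'
  obtain ⟨hpV, hpt, hpa, hpb⟩ := hpW'
  refine ⟨p, hpV, hpa, hpb, hpt, s p, hps, hps1, ?_, ?_, ?_⟩
  · rw [segment_eq_image']
    have : 0 ≤ baryB a b d p := ((mem_triangle_iff h).1 hpt).1
    refine ⟨1 - baryB a b d p, ⟨by linarith, by linarith⟩, ?_⟩
    simp only
    rw [show a + s p • (d - a) - b = a - b + s p • (d - a) by abel, ← hpe]; abel
  · set c := a + s p • (d - a) with hc
    have hca : c - a = s p • (d - a) := by rw [hc]; abel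
    have hcross : cross (b - a) (c - a) ≠ 0 := by
      rw [hca]
      have : cross (b - a) (s p • (d - a)) = s p * cross (b - a) (d - a) := by
        simp only [cross, PiLp.smul_apply, smul_eq_mul]; ring
      rw [this]; exact mul_ne_zero hps.ne' h
    have hcd : c ∈ segment ℝ a d := by
      rw [segment_eq_image']; exact ⟨s p, ⟨hps.le, hps1⟩, rfl⟩
    refine disjoint_triangle_inside (V := V) hS hcross hab ?_ ?_ ?_
    · intro P hP
      exact (had P hP).mono_left ((convex_segment a d).segment_subset (left_mem_segment _ _ _) hcd)
    · intro z hz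
      rw [openSegment_eq_image'] at hz
      obtain ⟨t, ⟨ht0, ht1⟩, rfl⟩ := hz
      have hk : 0 < 1 - t + t * s p := by nlinarith
      refine (hfree (b + (t * s p / (1 - t + t * s p)) • (d - b)) ?_).smul hk ?_
      · rw [segment_eq_image']
        refine ⟨_, ⟨by positivity, ?_⟩, rfl⟩
        rw [div_le_one hk]; linarith
      · have e1 : (1 - t + t * s p) • (b + (t * s p / (1 - t + t * s p)) • (d - b) - a) =
            (1 - t + t * s p) • (b - a) + (t * s p) • (d - b) := by
          rw [add_sub_right_comm, smul_add, smul_smul]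
          congr 2
          field_simp
        rw [e1, hc]
        simp only
        module
    · intro q hqV hqt
      by_cases hqa : q = a
      · exact Or.inl hqa
      right
      by_cases hqb : q = b
      · rw [hqb]; exact left_mem_segment _ _ _
      obtain ⟨β, γ, h1, h2, h3, he⟩ := hqt
      rw [hca, smul_smul] at he
      have hB := baryB_eq h β (γ * s p)
      have hC := baryC_eq h β (γ * s p)
      rw [← he] at hB hC
      have hqW : q ∈ W := by
        rw [hW, Finset.mem_filter]
        refine ⟨hqV, (mem_triangle_iff h).2 ⟨?_, ?_, ?_⟩, hqa, hqb⟩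
        · rw [hB]; exact h1
        · rw [hC]; positivity
        · rw [hB, hC]; nlinarith
      have hmin := hpmin q hqW
      have hlt := (hWfact q hqW).1
      rw [hB] at hlt
      have hmin' : s p ≤ γ * s p / (1 - β) := by simpa only [hs, hB, hC] using hmin
      rw [le_div_iff₀ (by linarith)] at hmin'
      have hγ : γ = 1 - β := by nlinarith
      rw [segment_eq_image']
      refine ⟨γ, ⟨h2, by linarith⟩, ?_⟩
      rw [he, hc]
      have : β = 1 - γ := by linarith
      subst this
      simp only
      module
  · intro q hqV hqa hqt
    by_cases hqb : q = b
    · rw [hqb]; simp [cross]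
    have hqW : q ∈ W := by
      rw [hW, Finset.mem_filter]; exact ⟨hqV, hqt, hqa, hqb⟩
    have hqe := hbV q hqW
    have h1 := (hWfact q hqW).1
    have h2 := hpmin q hqW
    have : cross (p - b) (q - b) * cross (b - a) (d - a) =
        -((1 - baryB a b d p) * (1 - baryB a b d q) * (s q - s p) * cross (b - a) (d - a) ^ 2) := by
      rw [hpe, hqe]
      generalize s p = sp, s q = sq, baryB a b d p = bp, baryB a b d q = bq
      simp only [cross, PiLp.smul_apply, smul_eq_mul, PiLp.add_apply, PiLp.sub_apply]; ring
    rw [this, neg_nonpos]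
    have h3 : 0 ≤ 1 - baryB a b d p := by linarith
    have h4 : 0 ≤ 1 - baryB a b d q := by linarith
    have h5 : 0 ≤ s q - s p := by linarith
    positivity

end emptyTriangle

/-! ### Triangular coordinates -/

/-- The three signed lengths of the projections of a vector on the bisectors of the positive cones.
Their sum vanishes. -/
noncomputable def coord (i : Fin 3) : Plane →ₗ[ℝ] ℝ := (innerSL ℝ (bisector i)).toLinearMap

lemma projLength_eq (u : Plane) (i : Fin 3) (v : Plane) : projLength u i v = coord i (v - u) := rfl

lemma coord_eq (i : Fin 3) (z : Plane) :
    coord i z = cos (bisectorAngle i) * z 0 + sin (bisectorAngle i) * z 1 := by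
  simp [coord, bisector, unitDir, PiLp.inner_apply, Fin.sum_univ_two, mul_comm]

lemma bisectorAngle_zero : bisectorAngle 0 = π / 2 := by simp [bisectorAngle]

lemma bisectorAngle_one : bisectorAngle 1 = π / 6 + π := by simp [bisectorAngle]; ring

lemma bisectorAngle_two : bisectorAngle 2 = 2 * π - π / 6 := by simp [bisectorAngle]; ring

lemma coord_zero (z : Plane) : coord 0 z = z 1 := by
  simp [coord_eq, bisectorAngle_zero]

lemma coord_one (z : Plane) : coord 1 z = -(√3 / 2) * z 0 - z 1 / 2 := by
  rw [coord_eq, bisectorAngle_one, cos_add_pi, sin_add_pi, cos_pi_div_six, sin_pi_div_six]; ring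

lemma coord_two (z : Plane) : coord 2 z = √3 / 2 * z 0 - z 1 / 2 := by
  rw [coord_eq, bisectorAngle_two, cos_two_pi_sub, sin_two_pi_sub, cos_pi_div_six,
    sin_pi_div_six]; ring

/-- `i`, `j`, `k` are the three indices of the positive cones, in some order. -/
def IsTriple (i j k : Fin 3) : Prop := i ≠ j ∧ j ≠ k ∧ i ≠ k

namespace IsTriple

variable {i j k : Fin 3}

lemma swap (h : IsTriple i j k) : IsTriple i k j := ⟨h.2.2, h.2.1.symm, h.1⟩

lemma left (h : IsTriple i j k) : IsTriple j i k := ⟨h.1.symm, h.2.2, h.2.1⟩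

lemma cases (h : IsTriple i j k) : (i = 0 ∧ j = 1 ∧ k = 2) ∨ (i = 0 ∧ j = 2 ∧ k = 1) ∨
    (i = 1 ∧ j = 0 ∧ k = 2) ∨ (i = 1 ∧ j = 2 ∧ k = 0) ∨ (i = 2 ∧ j = 0 ∧ k = 1) ∨
    (i = 2 ∧ j = 1 ∧ k = 0) := by
  unfold IsTriple at h
  omega

lemma exists_of (i : Fin 3) : ∃ j k, IsTriple i j k := by
  unfold IsTriple
  revert i
  decide

lemma eq_of (h : IsTriple i j k) (l : Fin 3) : l = i ∨ l = j ∨ l = k := by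
  unfold IsTriple at h
  omega

lemma sum_eq (h : IsTriple i j k) (z : Plane) : coord i z + coord j z + coord k z = 0 := by
  rcases h.cases with ⟨rfl, rfl, rfl⟩ | ⟨rfl, rfl, rfl⟩ | ⟨rfl, rfl, rfl⟩ | ⟨rfl, rfl, rfl⟩ |
    ⟨rfl, rfl, rfl⟩ | ⟨rfl, rfl, rfl⟩ <;> rw [coord_zero, coord_one, coord_two] <;> ring

lemma norm_sq (h : IsTriple i j k) (z : Plane) :
    ‖z‖ ^ 2 = 2 / 3 * (coord i z ^ 2 + coord j z ^ 2 + coord k z ^ 2) := by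
  have h3 : √3 ^ 2 = 3 := Real.sq_sqrt (by norm_num)
  rw [EuclideanSpace.norm_sq_eq, Fin.sum_univ_two, Real.norm_eq_abs, Real.norm_eq_abs, sq_abs,
    sq_abs]
  rcases h.cases with ⟨rfl, rfl, rfl⟩ | ⟨rfl, rfl, rfl⟩ | ⟨rfl, rfl, rfl⟩ | ⟨rfl, rfl, rfl⟩ |
    ⟨rfl, rfl, rfl⟩ | ⟨rfl, rfl, rfl⟩ <;> rw [coord_zero, coord_one, coord_two] <;>
    linear_combination (-(1 : ℝ) / 3 * z 0 ^ 2) * h3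

end IsTriple

/-- The area form expressed by the coordinates `j` and `k`. -/
noncomputable def coordCross (j k : Fin 3) (z w : Plane) : ℝ :=
  coord j z * coord k w - coord k z * coord j w

lemma IsTriple.coordCross_eq {i j k : Fin 3} (h : IsTriple i j k) :
    ∃ σ : ℝ, σ ≠ 0 ∧ ∀ z w, coordCross j k z w = σ * cross z w := by
  have h3 : √3 ≠ 0 := by simp
  rcases h.cases with ⟨rfl, rfl, rfl⟩ | ⟨rfl, rfl, rfl⟩ | ⟨rfl, rfl, rfl⟩ | ⟨rfl, rfl, rfl⟩ |
    ⟨rfl, rfl, rfl⟩ | ⟨rfl, rfl, rfl⟩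
  · exact ⟨√3 / 2, by simp, fun z w => by
      rw [coordCross, coord_one, coord_two, coord_one, coord_two, cross]; ring⟩
  · exact ⟨-(√3 / 2), by simp, fun z w => by
      rw [coordCross, coord_one, coord_two, coord_one, coord_two, cross]; ring⟩
  · exact ⟨-(√3 / 2), by simp, fun z w => by
      rw [coordCross, coord_zero, coord_two, coord_zero, coord_two, cross]; ring⟩
  · exact ⟨√3 / 2, by simp, fun z w => by
      rw [coordCross, coord_zero, coord_two, coord_zero, coord_two, cross]; ring⟩
  · exact ⟨√3 / 2, by simp, fun z w => by
      rw [coordCross, coord_zero, coord_one, coord_zero, coord_one, cross]; ring⟩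
  · exact ⟨-(√3 / 2), by simp, fun z w => by
      rw [coordCross, coord_zero, coord_one, coord_zero, coord_one, cross]; ring⟩

lemma norm_bisector (i : Fin 3) : ‖bisector i‖ = 1 := by
  rw [← sq_eq_sq₀ (norm_nonneg _) zero_le_one, EuclideanSpace.norm_sq_eq, Fin.sum_univ_two]
  simp [bisector, unitDir]

lemma angle_le_iff {z : Plane} (hz : z ≠ 0) (i : Fin 3) :
    InnerProductGeometry.angle z (bisector i) ≤ π / 6 ↔ √3 / 2 * ‖z‖ ≤ coord i z := by
  have hz' : 0 < ‖z‖ := norm_pos_iff.2 hz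
  have h1 : InnerProductGeometry.angle z (bisector i) ∈ Set.Icc 0 π :=
    ⟨InnerProductGeometry.angle_nonneg _ _, InnerProductGeometry.angle_le_pi _ _⟩
  have h2 : π / 6 ∈ Set.Icc 0 π := ⟨by positivity, by linarith [pi_pos]⟩
  rw [← Real.strictAntiOn_cos.le_iff_ge h2 h1, cos_pi_div_six, InnerProductGeometry.cos_angle,
    norm_bisector, mul_one, le_div_iff₀ hz', real_inner_comm]
  rfl

lemma IsTriple.mem_positiveCone_iff {i j k : Fin 3} (h : IsTriple i j k) {u x : Plane} :
    x ∈ positiveCone u i ↔ x ≠ u ∧ coord j (x - u) ≤ 0 ∧ coord k (x - u) ≤ 0 := by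
  show (x ≠ u ∧ _) ↔ _
  refine and_congr_right fun hx => ?_
  have hz : x - u ≠ 0 := sub_ne_zero.2 hx
  rw [angle_le_iff hz]
  generalize x - u = z at hz
  have hN : 0 < ‖z‖ := norm_pos_iff.2 hz
  have hs := h.sum_eq z
  have hn := h.norm_sq z
  have h3 : √3 ^ 2 = 3 := Real.sq_sqrt (by norm_num)
  have h30 : 0 < √3 := by positivity
  generalize ‖z‖ = N at *
  generalize coord i z = x, coord j z = y, coord k z = w at *
  obtain rfl : x = -(y + w) := by linarith
  constructor
  · intro hle
    have h4 : 0 < √3 / 2 * N := by positivity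
    have h5 : (√3 / 2 * N) ^ 2 ≤ (-(y + w)) ^ 2 := pow_le_pow_left₀ h4.le hle 2
    have h6 : (√3 / 2 * N) ^ 2 = 3 / 4 * N ^ 2 := by rw [mul_pow, div_pow, h3]; norm_num
    rw [h6, hn] at h5
    have h7 : 0 ≤ y * w := by nlinarith
    constructor
    · by_contra hy; push Not at hy; nlinarith
    · by_contra hy; push Not at hy; nlinarith
  · rintro ⟨hy, hw⟩
    refine le_of_sq_le_sq ?_ (by linarith)
    rw [mul_pow, div_pow, h3, hn]
    nlinarith [mul_nonneg_of_nonpos_of_nonpos hy hw]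

lemma mem_positiveCone_coord_pos {i : Fin 3} {u x : Plane} (hx : x ∈ positiveCone u i) :
    0 < coord i (x - u) := by
  have hz : x - u ≠ 0 := sub_ne_zero.2 hx.1
  have := (angle_le_iff hz i).1 hx.2
  have : 0 < √3 / 2 * ‖x - u‖ := by
    have := norm_pos_iff.2 hz
    positivity
  linarith

lemma eq_smul_of_cross_eq_zero {z w : Plane} (hz : z ≠ 0) (h : cross z w = 0) :
    ∃ r : ℝ, w = r • z := by
  have hN : z 0 ^ 2 + z 1 ^ 2 ≠ 0 := by
    intro h0
    apply hz
    ext j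
    fin_cases j
    · simp only [Fin.zero_eta, PiLp.zero_apply]
      nlinarith [sq_nonneg (z 0), sq_nonneg (z 1)]
    · simp only [Fin.mk_one, PiLp.zero_apply]
      nlinarith [sq_nonneg (z 0), sq_nonneg (z 1)]
  refine ⟨(z 0 * w 0 + z 1 * w 1) / (z 0 ^ 2 + z 1 ^ 2), ?_⟩
  unfold cross at h
  ext j
  simp only [PiLp.smul_apply, smul_eq_mul]
  rw [div_mul_eq_mul_div, eq_div_iff hN]
  fin_cases j
  · simp only [Fin.zero_eta]; linear_combination (-z 1) * h
  · simp only [Fin.mk_one]; linear_combination (z 0) * h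

namespace GeneralPosition

variable {V : Finset Plane}

lemma coord_ne_zero (hV : GeneralPosition V) {u v : Plane} (hu : u ∈ V) (hv : v ∈ V) (huv : u ≠ v)
    (i : Fin 3) : coord i (v - u) ≠ 0 := by
  intro h0
  have key : ∃ l : Fin 3, ∃ c : ℝ, v - u = c • leftBoundary l := by
    generalize v - u = z at h0
    fin_cases i
    · refine ⟨2, z 0, ?_⟩
      have : bisectorAngle 2 + π / 6 = 2 * π := by rw [bisectorAngle_two]; ring
      rw [leftBoundary, this]
      simp only [Fin.zero_eta, coord_zero] at h0
      ext l; fin_cases l <;> simp [unitDir, h0]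
    · refine ⟨0, -2 * z 0, ?_⟩
      have : bisectorAngle 0 + π / 6 = π - π / 3 := by rw [bisectorAngle_zero]; ring
      rw [leftBoundary, this]
      simp only [Fin.mk_one, coord_one] at h0
      ext l; fin_cases l <;> simp [unitDir, -cos_pi_sub]
      · rw [cos_pi_sub, cos_pi_div_three]; ring
      · linear_combination (-2) * h0
    · refine ⟨1, -2 * z 0, ?_⟩
      have : bisectorAngle 1 + π / 6 = π / 3 + π := by rw [bisectorAngle_one]; ring
      rw [leftBoundary, this]
      simp only [Fin.reduceFinMk, coord_two] at h0
      ext l; fin_cases l <;> simp [unitDir]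
      · ring
      · linear_combination (-2) * h0
  obtain ⟨l, c, hc⟩ := key
  exact (hV.1 u hu v hv huv l c).1 hc

lemma cross_ne_zero (hV : GeneralPosition V) {a b c : Plane} (ha : a ∈ V) (hb : b ∈ V) (hc : c ∈ V)
    (hab : a ≠ b) (hbc : b ≠ c) (hac : a ≠ c) : cross (b - a) (c - a) ≠ 0 := by
  intro h
  obtain ⟨r, hr⟩ := eq_smul_of_cross_eq_zero (sub_ne_zero.2 hab.symm) h
  refine hV.2 a ha b hb c hc hab hbc hac ?_
  rw [collinear_iff_of_mem (p₀ := a) (by simp)]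
  refine ⟨b - a, ?_⟩
  rintro p (rfl | rfl | rfl)
  · exact ⟨0, by simp⟩
  · exact ⟨1, by simp⟩
  · exact ⟨r, by rw [← hr]; simp⟩

lemma eq_or_eq_of_mem_segment (hV : GeneralPosition V) {a b c : Plane} (ha : a ∈ V) (hb : b ∈ V)
    (hc : c ∈ V) (h : c ∈ segment ℝ a b) : c = a ∨ c = b := by
  by_contra! hcon
  have hab : a ≠ b := by
    rintro rfl
    rw [segment_same] at h
    exact hcon.1 h
  exact hV.cross_ne_zero ha hb hc hab hcon.2.symm hcon.1.symm
    (cross_eq_zero_of_mem_segment h)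

end GeneralPosition

/-! ### Planarity -/

section planarity

variable {V : Finset Plane} {S : Finset SimplePolygon}

lemma coord_le_of_mem_triangle {l : Fin 3} {a b c q : Plane} {m : ℝ} (ha : coord l a ≤ m)
    (hb : coord l b ≤ m) (hc : coord l c ≤ m) (hq : q ∈ triangle a b c) : coord l q ≤ m := by
  obtain ⟨β, γ, h1, h2, h3, rfl⟩ := hq
  simp only [map_add, map_smul, map_sub, smul_eq_mul]
  nlinarith

/-- If a point `y` of `V` lies in the canonical triangle of an edge `uv` of the half-`Θ₆`-graph, it
is not visible from a point `x` of the edge: otherwise there would be a visible point of `V` in the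
triangle `x`, `u`, `y` that lies in the same subcone as `v`, but closer to `u`. -/
lemma IsClosestInSubcone.not_visible (hS : ∀ P ∈ S, P.corners ⊆ (V : Set Plane))
    (hV : GeneralPosition V) {u v x y : Plane} {i : Fin 3} (huv : IsClosestInSubcone V S u i v)
    (hu : u ∈ V) (hv : v ∈ V) (hx : x ∈ openSegment ℝ u v) (hxb : ∀ P ∈ S, x ∉ P.boundary)
    (hy : y ∈ V) (hyi : coord i y ≤ coord i v) (hyj : ∀ j ≠ i, coord j y ≤ coord j u)
    (hcr : cross (v - u) (y - x) ≠ 0) : ¬ Visible S x y := by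
  intro hxy
  obtain ⟨hcone, hvis, hmin⟩ := huv
  have hseg : segment ℝ x u ⊆ segment ℝ u v :=
    (convex_segment u v).segment_subset (openSegment_subset_segment _ _ _ hx)
      (left_mem_segment _ _ _)
  have hxu : Visible S x u := fun P hP => (hvis P hP).mono_left hseg
  have hxs := openSegment_subset_segment _ _ _ hx
  rw [openSegment_eq_image'] at hx
  obtain ⟨τ, ⟨hτ0, hτ1⟩, hτ⟩ := hx
  simp only at hτ
  have hxu' : u - x = (-τ) • (v - u) := by rw [← hτ]; module
  have hvx : v - x = (1 - τ) • (v - u) := by rw [← hτ]; module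
  have hD : cross (u - x) (y - x) ≠ 0 := by
    have : cross (u - x) (y - x) = -τ * cross (v - u) (y - x) := by
      rw [hxu']; simp only [cross, PiLp.smul_apply, smul_eq_mul]; ring
    rw [this]; exact mul_ne_zero (by linarith) hcr
  have hvtri : v ∉ triangle x u y := by
    intro hvt
    have h1 := ((mem_triangle_iff hD).1 hvt).1
    have h2 : baryB x u y v = -((1 - τ) / τ) := by
      rw [baryB, div_eq_iff hD, hvx, hxu']
      simp only [cross, PiLp.smul_apply, smul_eq_mul]
      field_simp
      ring
    have h3 : 0 < (1 - τ) / τ := div_pos (by linarith) hτ0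
    linarith
  have hfree : ∀ z, IsFreeDirection S x z := by
    intro z
    rw [isFreeDirection_iff]
    intro P hP
    exact (tendsto_add_smul x (z - x)).eventually (SimplePolygon.eventually_notMem_inside (hxb P hP)
      (Set.disjoint_left.1 (hvis P hP) hxs))
  obtain ⟨p, hpV, -, hpu, hpt, s, hs0, hs1, hps, hempty, -⟩ :=
    exists_first_point hS hD hxu hxy (fun z _ => hfree z) hy (by
      intro q hq hqs
      rcases hV.eq_or_eq_of_mem_segment hu hv hq (hseg hqs) with h | h
      · exact Or.inr h
      · subst h
        exfalso
        apply hvtri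
        rw [segment_eq_image'] at hqs
        obtain ⟨t, ⟨ht0, ht1⟩, ht⟩ := hqs
        exact ⟨t, 0, ht0, le_rfl, by linarith, by rw [← ht]; simp⟩)
  have hpv : p ≠ v := by rintro rfl; exact hvtri hpt
  set c := x + s • (y - x)
  have hpt' : p ∈ triangle x u c :=
    (convex_triangle x u c).segment_subset (mid_mem_triangle _ _ _) (right_mem_triangle _ _ _) hps
  have hcx : ∀ l m, coord l u ≤ m → coord l v ≤ m → coord l x ≤ m := by
    intro l m h1 h2
    rw [← hτ]
    simp only [map_add, map_smul, map_sub, smul_eq_mul]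
    nlinarith
  have hvpos := mem_positiveCone_coord_pos hcone
  rw [map_sub] at hvpos
  have hpi : coord i p ≤ coord i v :=
    coord_le_of_mem_triangle (hcx _ _ (by linarith) le_rfl) (by linarith) hyi hpt
  obtain ⟨j, k, hijk⟩ := IsTriple.exists_of i
  have hvc := (hijk.mem_positiveCone_iff.1 hcone).2
  simp only [map_sub, sub_nonpos] at hvc
  have hpcone : p ∈ positiveCone u i := by
    rw [hijk.mem_positiveCone_iff]
    simp only [map_sub, sub_nonpos]
    exact ⟨hpu, coord_le_of_mem_triangle (hcx _ _ le_rfl hvc.1) le_rfl (hyj j hijk.1.symm) hpt,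
      coord_le_of_mem_triangle (hcx _ _ le_rfl hvc.2) le_rfl (hyj k hijk.2.2.symm) hpt⟩
  have hsub : p ∈ subcone S u i v := by
    refine ⟨hpcone, fun z hz => ?_⟩
    rw [segment_eq_image'] at hz
    obtain ⟨t, ⟨ht0, ht1⟩, hz⟩ := hz
    simp only at hz
    -- shrunk by the factor `τ`, the segment from `v` to `p` starts in `x` and stays in the triangle
    have hmem : u + τ • (z - u) ∈ triangle x u c := by
      have h1 : u + τ • (p - u) ∈ triangle x u c :=
        (convex_triangle x u c).add_smul_sub_mem (mid_mem_triangle _ _ _) hpt' ⟨hτ0.le, hτ1.le⟩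
      have h2 := (convex_triangle x u c).add_smul_sub_mem (left_mem_triangle _ _ _) h1 ⟨ht0, ht1⟩
      convert h2 using 1
      rw [← hz, ← hτ]; module
    refine (visible_of_disjoint_triangle hempty (mid_mem_triangle _ _ _) hmem).isFreeDirection.smul
      (inv_pos.2 hτ0) ?_
    rw [add_sub_cancel_left, smul_smul, inv_mul_cancel₀ hτ0.ne', one_smul]
  have := hmin p hpV hpv hsub (visible_of_disjoint_triangle hempty (mid_mem_triangle _ _ _) hpt')
  rw [projLength_eq, projLength_eq, map_sub, map_sub] at this
  linarith

/-- Two triangles with sides of the same three directions, given by upper bounds on the coordinates: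
if chords of them meet, an end of one of the chords lies in the triangle of the other. -/
lemma exists_end_mem {B B' : Fin 3 → ℝ} {u v p q x : Plane} (hu : ∀ l, coord l u ≤ B l)
    (hv : ∀ l, coord l v ≤ B l) (hp : ∀ l, coord l p ≤ B' l) (hq : ∀ l, coord l q ≤ B' l)
    (hx : x ∈ segment ℝ u v) (hx' : x ∈ segment ℝ p q) :
    (∃ y, (y = u ∨ y = v) ∧ ∀ l, coord l y ≤ B' l) ∨
      (∃ y, (y = p ∨ y = q) ∧ ∀ l, coord l y ≤ B l) := by
  -- two of the three sides of one triangle are cut off by the other, whose chord meets the third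
  have key : ∀ {B B' : Fin 3 → ℝ} {u v p q x : Plane}, (∀ l, coord l u ≤ B l) →
      (∀ l, coord l v ≤ B l) → (∀ l, coord l p ≤ B' l) → (∀ l, coord l q ≤ B' l) →
      x ∈ segment ℝ u v → x ∈ segment ℝ p q → ∀ m : Fin 3, (∀ l ≠ m, B l ≤ B' l) →
      ∃ y, (y = u ∨ y = v) ∧ ∀ l, coord l y ≤ B' l := by
    intro B B' u v p q x hu hv hp hq hx hx' m hm
    by_contra! hcon
    have h1 : B' m < coord m u := by
      obtain ⟨l, hl⟩ := hcon u (Or.inl rfl)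
      by_cases hlm : l = m
      · rwa [← hlm]
      · linarith [hm l hlm, hu l]
    have h2 : B' m < coord m v := by
      obtain ⟨l, hl⟩ := hcon v (Or.inr rfl)
      by_cases hlm : l = m
      · rwa [← hlm]
      · linarith [hm l hlm, hv l]
    obtain ⟨s, t, hs, ht, hst, rfl⟩ := hx
    obtain ⟨s', t', hs', ht', hst', he⟩ := hx'
    have := congrArg (coord m) he
    simp only [map_add, map_smul, smul_eq_mul] at this
    have h3 := hp m
    have h4 := hq m
    have h5 : (s' + t') * B' m = B' m := by rw [hst', one_mul]
    have h6 : (s + t) * B' m = B' m := by rw [hst, one_mul]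
    have h7 := mul_le_mul_of_nonneg_left h3 hs'
    have h8 := mul_le_mul_of_nonneg_left h4 ht'
    rcases hs.eq_or_lt with rfl | hs0
    · have : t = 1 := by linarith
      subst this; linarith
    · have h9 := mul_lt_mul_of_pos_left h1 hs0
      have h10 := mul_le_mul_of_nonneg_left h2.le ht
      linarith
  have hmaj : (∃ m, ∀ l ≠ m, B l ≤ B' l) ∨ (∃ m, ∀ l ≠ m, B' l ≤ B l) := by
    have sel : ∀ (Q : Fin 3 → Prop), (Q 1 → Q 2 → ∃ m, ∀ l ≠ m, Q l) ∧
        (Q 0 → Q 2 → ∃ m, ∀ l ≠ m, Q l) ∧ (Q 0 → Q 1 → ∃ m, ∀ l ≠ m, Q l) := by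
      intro Q
      have t0 : IsTriple 0 1 2 := by unfold IsTriple; decide
      refine ⟨fun h h' => ⟨0, ?_⟩, fun h h' => ⟨1, ?_⟩, fun h h' => ⟨2, ?_⟩⟩ <;> intro l hl <;>
        rcases t0.eq_of l with rfl | rfl | rfl <;> first | assumption | exact absurd rfl hl
    have s1 := sel fun l => B l ≤ B' l
    have s2 := sel fun l => B' l ≤ B l
    rcases le_total (B 0) (B' 0) with h0 | h0 <;> rcases le_total (B 1) (B' 1) with h1 | h1 <;>
      rcases le_total (B 2) (B' 2) with h2 | h2
    · exact Or.inl (s1.1 h1 h2)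
    · exact Or.inl (s1.2.2 h0 h1)
    · exact Or.inl (s1.2.1 h0 h2)
    · exact Or.inr (s2.1 h1 h2)
    · exact Or.inl (s1.1 h1 h2)
    · exact Or.inr (s2.2.1 h0 h2)
    · exact Or.inr (s2.2.2 h0 h1)
    · exact Or.inr (s2.1 h1 h2)
  rcases hmaj with ⟨m, hm⟩ | ⟨m, hm⟩
  · exact Or.inl (key hu hv hp hq hx hx' m hm)
  · exact Or.inr (key hp hq hu hv hx' hx m hm)

lemma crossing_notMem_boundary (hS : ∀ P ∈ S, P.corners ⊆ (V : Set Plane))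
    {u v p q x : Plane} (huv : Visible S u v) (hpq : Visible S p q) (hxV : x ∉ V)
    (hx : x ∈ openSegment ℝ u v) (hx' : x ∈ openSegment ℝ p q)
    (hcr : cross (v - u) (q - p) ≠ 0) : ∀ P ∈ S, x ∉ P.boundary := by
  intro P hP hb
  obtain ⟨i, hi⟩ := P.mem_boundary.1 hb
  have hcorner : ∀ i, P.poly i ∈ V := fun i => hS P hP ⟨i, rfl⟩
  have ho : x ∈ openSegment ℝ (P.poly i) (P.poly (P.next i)) := by
    refine mem_openSegment_of_ne_left_right ?_ ?_ hi
    · rintro rfl; exact hxV (hcorner _)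
    · rintro rfl; exact hxV (hcorner _)
  have h1 := huv.not_crossed hP ho hx
  have h2 := hpq.not_crossed hP ho hx'
  have he : P.poly (P.next i) - P.poly i ≠ 0 := sub_ne_zero.2 (P.poly_next_ne i)
  obtain ⟨r, hr⟩ := eq_smul_of_cross_eq_zero he h1
  obtain ⟨r', hr'⟩ := eq_smul_of_cross_eq_zero he h2
  apply hcr
  rw [hr, hr']
  simp only [cross, PiLp.smul_apply, smul_eq_mul]; ring

lemma IsClosestInSubcone.exists_bounds {u v : Plane} {i : Fin 3}
    (h : IsClosestInSubcone V S u i v) : ∃ B : Fin 3 → ℝ, (∀ l, coord l u ≤ B l) ∧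
      (∀ l, coord l v ≤ B l) ∧ B i = coord i v ∧ ∀ j ≠ i, B j = coord j u := by
  obtain ⟨j, k, hijk⟩ := IsTriple.exists_of i
  have hpos := mem_positiveCone_coord_pos h.1
  have hvc := (hijk.mem_positiveCone_iff.1 h.1).2
  simp only [map_sub, sub_nonpos, sub_pos] at hvc hpos
  refine ⟨fun l => if l = i then coord i v else coord l u, ?_, ?_, by simp, ?_⟩
  · intro l
    by_cases hl : l = i
    · subst hl; simpa using hpos.le
    · simp [hl]
  · intro l
    rcases hijk.eq_of l with rfl | rfl | rfl
    · simp
    · simpa [hijk.1.symm] using hvc.1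
    · simpa [hijk.2.2.symm] using hvc.2
  · intro l hl
    simp [hl]

/-- Two edges of the half-`Θ₆`-graph do not cross. -/
lemma IsClosestInSubcone.not_cross (hS : ∀ P ∈ S, P.corners ⊆ (V : Set Plane))
    (hV : GeneralPosition V) {u v p q x : Plane} {i j : Fin 3}
    (huv : IsClosestInSubcone V S u i v) (hpq : IsClosestInSubcone V S p j q)
    (hu : u ∈ V) (hv : v ∈ V) (hp : p ∈ V) (hq : q ∈ V) (hx : x ∈ openSegment ℝ u v)
    (hx' : x ∈ openSegment ℝ p q) (hxV : x ∉ V) : cross (v - u) (q - p) = 0 := by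
  by_contra hcr
  have hxb := crossing_notMem_boundary hS huv.2.1 hpq.2.1 hxV hx hx' hcr
  obtain ⟨B, hBu, hBv, hBi, hBj⟩ := huv.exists_bounds
  obtain ⟨B', hBp, hBq, hBi', hBj'⟩ := hpq.exists_bounds
  have hxs := openSegment_subset_segment _ _ _ hx
  have hxs' := openSegment_subset_segment _ _ _ hx'
  have hvis : ∀ {u v y : Plane}, Visible S u v → x ∈ segment ℝ u v → y = u ∨ y = v →
      Visible S x y := by
    intro u v y h hx hy P hP
    refine (h P hP).mono_left ((convex_segment u v).segment_subset hx ?_)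
    rcases hy with rfl | rfl
    · exact left_mem_segment _ _ _
    · exact right_mem_segment _ _ _
  have hdir : ∀ {u v y : Plane}, x ∈ openSegment ℝ u v → y = u ∨ y = v →
      ∃ r : ℝ, r ≠ 0 ∧ y - x = r • (v - u) := by
    intro u v y hx hy
    rw [openSegment_eq_image'] at hx
    obtain ⟨t, ⟨ht0, ht1⟩, rfl⟩ := hx
    rcases hy with rfl | rfl
    · exact ⟨-t, by linarith, by module⟩
    · exact ⟨1 - t, by linarith, by module⟩
  rcases exists_end_mem hBu hBv hBp hBq hxs hxs' with ⟨y, hy, hyB⟩ | ⟨y, hy, hyB⟩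
  · refine hpq.not_visible hS hV hp hq hx' hxb (y := y) (by rcases hy with rfl | rfl <;> assumption)
      (hBi' ▸ hyB j) (fun l hl => hBj' l hl ▸ hyB l) ?_ (hvis huv.2.1 hxs hy)
    obtain ⟨r, hr, he⟩ := hdir hx hy
    rw [he]
    intro h0
    apply mul_ne_zero hr hcr
    simp only [cross, PiLp.smul_apply, smul_eq_mul] at h0 ⊢
    linear_combination -h0
  · refine huv.not_visible hS hV hu hv hx hxb (y := y) (by rcases hy with rfl | rfl <;> assumption)
      (hBi ▸ hyB i) (fun l hl => hBj l hl ▸ hyB l) ?_ (hvis hpq.2.1 hxs' hy)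
    obtain ⟨r, hr, he⟩ := hdir hx' hy
    rw [he]
    intro h0
    apply mul_ne_zero hr hcr
    simp only [cross, PiLp.smul_apply, smul_eq_mul] at h0 ⊢
    linear_combination h0

theorem isPlane_halfThetaSix (hS : ∀ P ∈ S, P.corners ⊆ (V : Set Plane))
    (hV : GeneralPosition V) : IsPlane (halfThetaSix V S) := by
  have h1 : ∀ a b w : V, (w : Plane) ∈ segment ℝ (a : Plane) (b : Plane) → w = a ∨ w = b := by
    intro a b w h
    exact (hV.eq_or_eq_of_mem_segment a.2 b.2 w.2 h).imp Subtype.ext Subtype.ext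
  refine ⟨fun a b w _ => h1 a b w, ?_⟩
  rintro a b c d hab hcd hne x ⟨hx, hx'⟩
  by_cases hxV : x ∈ V
  · exact ⟨(h1 a b ⟨x, hxV⟩ hx).imp (congrArg Subtype.val) (congrArg Subtype.val),
      (h1 c d ⟨x, hxV⟩ hx').imp (congrArg Subtype.val) (congrArg Subtype.val)⟩
  exfalso
  have hxo : x ∈ openSegment ℝ (a : Plane) b := by
    refine mem_openSegment_of_ne_left_right ?_ ?_ hx
    · rintro rfl; exact hxV a.2
    · rintro rfl; exact hxV b.2
  have hxo' : x ∈ openSegment ℝ (c : Plane) d := by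
    refine mem_openSegment_of_ne_left_right ?_ ?_ hx'
    · rintro rfl; exact hxV c.2
    · rintro rfl; exact hxV d.2
  have hcr : cross ((b : Plane) - a) ((d : Plane) - c) = 0 := by
    obtain ⟨-, hab⟩ := hab
    obtain ⟨-, hcd⟩ := hcd
    rcases hab with ⟨i, hi⟩ | ⟨i, hi⟩ <;> rcases hcd with ⟨j, hj⟩ | ⟨j, hj⟩
    · exact hi.not_cross hS hV hj a.2 b.2 c.2 d.2 hxo hxo' hxV
    · have := hi.not_cross hS hV hj a.2 b.2 d.2 c.2 hxo
        (openSegment_symm ℝ (c : Plane) d ▸ hxo') hxV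
      simp only [cross, PiLp.sub_apply] at this ⊢
      linear_combination -this
    · have := hi.not_cross hS hV hj b.2 a.2 c.2 d.2
        (openSegment_symm ℝ (a : Plane) b ▸ hxo) hxo' hxV
      simp only [cross, PiLp.sub_apply] at this ⊢
      linear_combination -this
    · have := hi.not_cross hS hV hj b.2 a.2 d.2 c.2 (openSegment_symm ℝ (a : Plane) b ▸ hxo)
        (openSegment_symm ℝ (c : Plane) d ▸ hxo') hxV
      simp only [cross, PiLp.sub_apply] at this ⊢
      linear_combination this
  -- the two edges lie on one line, which contains no three points of `V`
  have hab' : (a : Plane) ≠ b := fun h => hab.ne (Subtype.ext h)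
  have hba0 : (b : Plane) - a ≠ 0 := sub_ne_zero.2 hab'.symm
  obtain ⟨r, hr⟩ := eq_smul_of_cross_eq_zero hba0 hcr
  rw [openSegment_eq_image'] at hxo hxo'
  obtain ⟨t, -, ht⟩ := hxo
  obtain ⟨t', -, ht'⟩ := hxo'
  simp only at ht ht'
  have hon : ∀ e : V, (∃ m : ℝ, (e : Plane) - a = m • ((b : Plane) - a)) → e = a ∨ e = b := by
    rintro e ⟨m, hm⟩
    by_contra! hcon
    refine hV.cross_ne_zero a.2 b.2 e.2 hab' (fun h => hcon.2 (Subtype.ext h.symm))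
      (fun h => hcon.1 (Subtype.ext h.symm)) ?_
    rw [hm]
    simp only [cross, PiLp.smul_apply, smul_eq_mul]; ring
  have hca : (c : Plane) - a = (t - t' * r) • ((b : Plane) - a) := by
    rw [sub_smul, mul_smul, ← hr, eq_sub_iff_add_eq]
    have : (c : Plane) + t' • ((d : Plane) - c) = a + t • ((b : Plane) - a) := by rw [ht, ht']
    rw [sub_add_eq_add_sub, this, add_sub_cancel_left]
  have hc := hon c ⟨_, hca⟩
  have hd := hon d ⟨t - t' * r + r, by
    rw [add_smul, ← hca, ← hr]; abel⟩
  have hcdne := hcd.ne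
  apply hne
  rcases hc with rfl | rfl <;> rcases hd with rfl | rfl
  · exact absurd rfl hcdne
  · rfl
  · exact Sym2.eq_swap
  · exact absurd rfl hcdne

end planarity

/-! ### Lengths of walks -/

section walks

variable {V : Finset Plane} {G : SimpleGraph V}

lemma walkLength_append {x y z : V} (p : G.Walk x y) (q : G.Walk y z) :
    walkLength (p.append q) = walkLength p + walkLength q := by
  simp [walkLength, SimpleGraph.Walk.darts_append]

lemma walkLength_reverse {x y : V} (p : G.Walk x y) : walkLength p.reverse = walkLength p := by
  simp only [walkLength, SimpleGraph.Walk.darts_reverse, List.map_reverse, List.map_map,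
    List.sum_reverse]
  congr 2
  funext d
  simp [dist_comm]

/-- `x` and `y` are points of `V` joined by a walk of length at most `ℓ` in the
half-`Θ₆`-graph. -/
def HasWalk (V : Finset Plane) (S : Finset SimplePolygon) (x y : Plane) (ℓ : ℝ) : Prop :=
  ∃ (hx : x ∈ V) (hy : y ∈ V) (p : (halfThetaSix V S).Walk ⟨x, hx⟩ ⟨y, hy⟩), walkLength p ≤ ℓ

variable {S : Finset SimplePolygon} {x y z : Plane} {ℓ ℓ' : ℝ}

lemma HasWalk.symm (h : HasWalk V S x y ℓ) : HasWalk V S y x ℓ := by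
  obtain ⟨hx, hy, p, hp⟩ := h
  exact ⟨hy, hx, p.reverse, by rwa [walkLength_reverse]⟩

lemma HasWalk.trans (h : HasWalk V S x y ℓ) (h' : HasWalk V S y z ℓ') :
    HasWalk V S x z (ℓ + ℓ') := by
  obtain ⟨hx, hy, p, hp⟩ := h
  obtain ⟨_, hz, q, hq⟩ := h'
  exact ⟨hx, hz, p.append q, by rw [walkLength_append]; exact add_le_add hp hq⟩

lemma HasWalk.mono (h : HasWalk V S x y ℓ) (hle : ℓ ≤ ℓ') : HasWalk V S x y ℓ' := by
  obtain ⟨hx, hy, p, hp⟩ := h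
  exact ⟨hx, hy, p, hp.trans hle⟩

lemma IsClosestInSubcone.hasWalk {u v : Plane} {i : Fin 3} (h : IsClosestInSubcone V S u i v)
    (hu : u ∈ V) (hv : v ∈ V) : HasWalk V S u v ‖v - u‖ := by
  have hadj : (halfThetaSix V S).Adj ⟨u, hu⟩ ⟨v, hv⟩ :=
    ⟨fun he => h.1.1 (congrArg Subtype.val he).symm, Or.inl ⟨i, h⟩⟩
  refine ⟨hu, hv, hadj.toWalk, ?_⟩
  simp [walkLength, dist_eq_norm, norm_sub_rev]

end walks

/-! ### Subcones -/

namespace IsTriple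

variable {i j k : Fin 3}

lemma ext_coord (h : IsTriple i j k) {z w : Plane} (hi : coord i z = coord i w)
    (hj : coord j z = coord j w) : z = w := by
  have h1 := h.sum_eq (z - w)
  have h2 := h.norm_sq (z - w)
  have hi' : coord i (z - w) = 0 := by rw [map_sub, hi, sub_self]
  have hj' : coord j (z - w) = 0 := by rw [map_sub, hj, sub_self]
  rw [hi', hj'] at h1 h2
  have hk' : coord k (z - w) = 0 := by linarith
  rw [hk'] at h2
  have : ‖z - w‖ = 0 := by
    have : ‖z - w‖ ^ 2 = 0 := by rw [h2]; norm_num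
    simpa using this
  exact sub_eq_zero.1 (norm_eq_zero.1 this)

variable {S : Finset SimplePolygon} {u : Plane}

/-- The slope `coord j / coord i` parametrizes the directions of the `i`-th cone. -/
lemma isFreeDirection_of_slope (h : IsTriple i j k) {x y z : Plane}
    (hx : 0 < coord i (x - u)) (hy : 0 < coord i (y - u)) (hz : 0 < coord i (z - u))
    (hfree : ∀ q ∈ segment ℝ x y, IsFreeDirection S u q)
    (hslope : coord j (z - u) / coord i (z - u) ∈
      Set.uIcc (coord j (x - u) / coord i (x - u)) (coord j (y - u) / coord i (y - u))) :
    IsFreeDirection S u z := by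
  set τ := coord j (z - u) / coord i (z - u) with hτ
  set f : ℝ → ℝ := fun s =>
    coord j (x + s • (y - x) - u) - τ * coord i (x + s • (y - x) - u) with hf
  have hfc : Continuous f := by
    simp only [hf, map_sub, map_add, map_smul, smul_eq_mul]
    fun_prop
  have h0 : f 0 = (coord j (x - u) / coord i (x - u) - τ) * coord i (x - u) := by
    simp only [hf, zero_smul, add_zero]
    field_simp
  have h1 : f 1 = (coord j (y - u) / coord i (y - u) - τ) * coord i (y - u) := by
    simp only [hf, one_smul, add_sub_cancel]
    field_simp
  obtain ⟨s, hs, hs0⟩ : ∃ s ∈ Set.Icc (0 : ℝ) 1, f s = 0 := by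
    rcases Set.mem_uIcc.1 hslope with ⟨ha, hb⟩ | ⟨ha, hb⟩
    · refine intermediate_value_Icc zero_le_one hfc.continuousOn ⟨?_, ?_⟩
      · rw [h0]; exact mul_nonpos_of_nonpos_of_nonneg (by linarith) hx.le
      · rw [h1]; exact mul_nonneg (by linarith) hy.le
    · refine intermediate_value_Icc' zero_le_one hfc.continuousOn ⟨?_, ?_⟩
      · rw [h1]; exact mul_nonpos_of_nonpos_of_nonneg (by linarith) hy.le
      · rw [h0]; exact mul_nonneg (by linarith) hx.le
  have hq : x + s • (y - x) ∈ segment ℝ x y := by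
    rw [segment_eq_image']; exact ⟨s, hs, rfl⟩
  have hqi : 0 < coord i (x + s • (y - x) - u) := by
    have : coord i (x + s • (y - x) - u) = (1 - s) * coord i (x - u) + s * coord i (y - u) := by
      simp only [map_sub, map_add, map_smul, smul_eq_mul]; ring
    rw [this]
    rcases hs.1.eq_or_lt with hs0 | hs0
    · rw [← hs0]; linarith
    · have := mul_pos hs0 hy
      have := mul_nonneg (sub_nonneg.2 hs.2) hx.le
      linarith
  refine (hfree _ hq).smul (div_pos hz hqi) (h.ext_coord ?_ ?_)
  · rw [map_smul, smul_eq_mul, div_mul_cancel₀ _ hqi.ne']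
  · rw [map_smul, smul_eq_mul]
    have : coord j (x + s • (y - x) - u) = τ * coord i (x + s • (y - x) - u) := by
      simp only [hf] at hs0; linarith
    rw [this, hτ]
    field_simp

lemma slope_mem_uIcc {x y z : Plane}
    (hx : 0 < coord i (x - u)) (hy : 0 < coord i (y - u)) (hz : z ∈ segment ℝ x y) :
    0 < coord i (z - u) ∧ coord j (z - u) / coord i (z - u) ∈
      Set.uIcc (coord j (x - u) / coord i (x - u)) (coord j (y - u) / coord i (y - u)) := by
  obtain ⟨s, t, hs, ht, hst, rfl⟩ := hz
  have key : ∀ l, coord l (s • x + t • y - u) = s * coord l (x - u) + t * coord l (y - u) := by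
    intro l
    have : s • x + t • y - u = s • (x - u) + t • (y - u) := by
      have : s = 1 - t := by linarith
      subst this; module
    rw [this, map_add, map_smul, map_smul, smul_eq_mul, smul_eq_mul]
  rw [key i, key j]
  generalize coord i (x - u) = a at *
  generalize coord i (y - u) = b at *
  generalize coord j (x - u) = p at *
  generalize coord j (y - u) = q at *
  have hpos : 0 < s * a + t * b := by
    rcases hs.eq_or_lt with rfl | hs0
    · have : t = 1 := by linarith
      subst this; linarith
    · have := mul_pos hs0 hx
      have := mul_nonneg ht hy.le
      linarith
  refine ⟨hpos, Set.mem_uIcc.2 ?_⟩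
  rcases le_total (p / a) (q / b) with hle | hle
  · left
    rw [div_le_div_iff₀ hx hy] at hle
    rw [div_le_div_iff₀ hx hpos, div_le_div_iff₀ hpos hy]
    constructor <;> nlinarith
  · right
    rw [div_le_div_iff₀ hy hx] at hle
    rw [div_le_div_iff₀ hy hpos, div_le_div_iff₀ hpos hx]
    constructor <;> nlinarith

end IsTriple

section subcones

variable {V : Finset Plane} {S : Finset SimplePolygon} {u v w : Plane} {i : Fin 3}

/-- Being in the same subcone is transitive. -/
lemma mem_subcone_trans {v' : Plane} (hw : w ∈ positiveCone u i) (hv : v ∈ subcone S u i w)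
    (hv' : v' ∈ subcone S u i v) : v' ∈ subcone S u i w := by
  obtain ⟨j, k, h⟩ := IsTriple.exists_of i
  have pw := mem_positiveCone_coord_pos hw
  have pv := mem_positiveCone_coord_pos hv.1
  have pv' := mem_positiveCone_coord_pos hv'.1
  refine ⟨hv'.1, fun z hz => ?_⟩
  obtain ⟨pz, hsl⟩ := IsTriple.slope_mem_uIcc (j := j) pw pv' hz
  rcases Set.uIcc_subset_uIcc_union_uIcc
    (b := coord j (v - u) / coord i (v - u)) hsl with hsl | hsl
  · exact h.isFreeDirection_of_slope pw pv pz hv.2 hsl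
  · exact h.isFreeDirection_of_slope pv pv' pz hv'.2 hsl

/-- The subcone of a visible point contains a closest visible point. -/
lemma exists_isClosestInSubcone (hV : GeneralPosition V) (hw : w ∈ V)
    (hcone : w ∈ positiveCone u i) (hvis : Visible S u w) :
    ∃ v ∈ V, v ∈ subcone S u i w ∧ IsClosestInSubcone V S u i v ∧
      ∀ q ∈ V, q ∈ subcone S u i w → Visible S u q → coord i (v - u) ≤ coord i (q - u) := by
  classical
  set W := V.filter fun q => q ∈ subcone S u i w ∧ Visible S u q with hW
  have hmem : ∀ q, q ∈ W ↔ q ∈ V ∧ q ∈ subcone S u i w ∧ Visible S u q := by simp [hW]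
  have hwW : w ∈ W := by
    rw [hmem]
    refine ⟨hw, ⟨hcone, fun x hx => ?_⟩, hvis⟩
    rw [segment_same] at hx
    rw [Set.mem_singleton_iff.1 hx]
    exact hvis.isFreeDirection
  obtain ⟨v, hvW, hmin⟩ := W.exists_min_image (fun q => coord i (q - u)) ⟨w, hwW⟩
  obtain ⟨hvV, hvs, hvv⟩ := (hmem v).1 hvW
  refine ⟨v, hvV, hvs, ⟨hvs.1, hvv, ?_⟩, fun q h1 h2 h3 => hmin q ((hmem q).2 ⟨h1, h2, h3⟩)⟩
  intro q hqV hqv hqs hqvis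
  have hle := hmin q ((hmem q).2 ⟨hqV, mem_subcone_trans hcone hvs hqs, hqvis⟩)
  rw [projLength_eq, projLength_eq]
  refine lt_of_le_of_ne hle fun he => ?_
  apply hV.coord_ne_zero hvV hqV hqv.symm i
  simp only [map_sub] at he ⊢
  linarith

end subcones

/-! ### Convex chains -/

section chains

variable {V : Finset Plane} {S : Finset SimplePolygon} {i j k : Fin 3} {u w : Plane}

lemma coordCross_sub_left (j k : Fin 3) (a b c : Plane) :
    coordCross j k (a - b) c = coordCross j k a c - coordCross j k b c := by
  simp only [coordCross, map_sub]; ring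

lemma coordCross_sub_right (j k : Fin 3) (a b c : Plane) :
    coordCross j k c (a - b) = coordCross j k c a - coordCross j k c b := by
  simp only [coordCross, map_sub]; ring

/-- The linear relation between three vectors of the plane, in a coordinate. -/
lemma coord_mul_coordCross (h : IsTriple i j k) (l : Fin 3) (a b c : Plane) :
    coord l a * coordCross j k b c =
      coord l b * coordCross j k a c - coord l c * coordCross j k a b := by
  have ha := h.sum_eq a
  have hb := h.sum_eq b
  have hc := h.sum_eq c
  simp only [coordCross]
  rcases h.eq_of l with rfl | rfl | rfl
  · rw [show coord l a = -(coord j a + coord k a) by linarith,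
      show coord l b = -(coord j b + coord k b) by linarith,
      show coord l c = -(coord j c + coord k c) by linarith]
    ring
  · ring
  · ring

lemma mem_triangle_of_coordCross (h : IsTriple i j k) {a b c q : Plane}
    (h0 : coordCross j k (b - a) (c - a) < 0) (h1 : coordCross j k (b - a) (q - a) ≤ 0)
    (h2 : coordCross j k (q - a) (c - a) ≤ 0) (h3 : coordCross j k (c - b) (q - b) ≤ 0) :
    q ∈ triangle a b c := by
  obtain ⟨σ, hσ, he⟩ := h.coordCross_eq
  have hcr : cross (b - a) (c - a) ≠ 0 := by
    intro h'; rw [he, h', mul_zero] at h0; exact lt_irrefl _ h0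
  have hB : baryB a b c q = coordCross j k (q - a) (c - a) / coordCross j k (b - a) (c - a) := by
    rw [he, he, mul_div_mul_left _ _ hσ]; rfl
  have hC : baryC a b c q = coordCross j k (b - a) (q - a) / coordCross j k (b - a) (c - a) := by
    rw [he, he, mul_div_mul_left _ _ hσ]; rfl
  rw [mem_triangle_iff hcr, hB, hC]
  refine ⟨div_nonneg_of_nonpos h2 h0.le, div_nonneg_of_nonpos h1 h0.le, ?_⟩
  rw [← add_div, div_le_one_of_neg h0]
  simp only [coordCross, map_sub] at *
  linarith

/-- A step `v`, `p` of a convex chain in the triangle `u`, `v`, `w`: an edge of the visibility graph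
such that no point of `V` in this triangle, except `u`, lies on the same side of the line `vp` as
`u`. The orientation is measured by `coordCross j k`; the point `v` lies on the same side of `uw` as
the boundary ray of the `i`-th cone of `u` with `coord j = 0`. -/
structure ChainStep (V : Finset Plane) (S : Finset SimplePolygon) (i j k : Fin 3)
    (u w v p : Plane) : Prop where
  left_mem : v ∈ V
  right_mem : p ∈ V
  ne : v ≠ p
  visible : Visible S v p
  left_j : coord j (v - u) < 0
  left_k : coord k (v - u) < 0
  right_j : coord j (p - u) < 0
  right_k : coord k (p - u) < 0
  right_le : coord i (p - u) ≤ coord i (w - u)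
  left_cross : coordCross j k (v - u) (w - u) < 0
  right_cross : coordCross j k (p - u) (w - u) ≤ 0
  step_cross : 0 < coordCross j k (p - v) (w - u)
  cross_step : coordCross j k (v - u) (p - v) < 0
  right_triangle : p ∈ triangle u v w
  min : ∀ q ∈ V, q ≠ u → q ∈ triangle u v w → 0 ≤ coordCross j k (p - v) (q - v)

/-- A convex chain of visible segments that leads from `v` to `w` and begins with the step from `v`
to `p`. -/
inductive ConvexChain (V : Finset Plane) (S : Finset SimplePolygon) (i j k : Fin 3)
    (u w : Plane) : Plane → Plane → Prop
  | last {v : Plane} : ChainStep V S i j k u w v w → ConvexChain V S i j k u w v w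
  | cons {v p q : Plane} : ChainStep V S i j k u w v p → ConvexChain V S i j k u w p q →
      0 ≤ coordCross j k (p - v) (q - p) → ConvexChain V S i j k u w v p

lemma ConvexChain.step {v p : Plane} (h : ConvexChain V S i j k u w v p) :
    ChainStep V S i j k u w v p := by
  cases h <;> assumption

/-- If `v` and `w` are visible from `u`, and no obstacle starts at `u` between them, then a convex
chain leads from `v` to `w` in the triangle `u`, `v`, `w`. -/
theorem exists_convexChain (hS : ∀ P ∈ S, P.corners ⊆ (V : Set Plane)) (hV : GeneralPosition V)
    (h : IsTriple i j k) (hu : u ∈ V) (hw : w ∈ V) (huw : Visible S u w)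
    (hwc : w ∈ positiveCone u i) {v : Plane} (hv : v ∈ V)
    (huv : Visible S u v) (hvc : v ∈ positiveCone u i)
    (hle : coord i (v - u) ≤ coord i (w - u))
    (hcr : coordCross j k (v - u) (w - u) < 0)
    (hfree : ∀ z ∈ segment ℝ v w, IsFreeDirection S u z) :
    ∃ p, ConvexChain V S i j k u w v p ∧ p ∈ positiveCone u i ∧ Visible S u p ∧
      (∀ z ∈ segment ℝ v p, IsFreeDirection S u z) := by
  classical
  obtain ⟨σ, hσ, he⟩ := h.coordCross_eq
  induction hn : (V.filter (· ∈ triangle u v w)).card using Nat.strong_induction_on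
    generalizing v with
  | _ n ih =>
  have hcross : cross (v - u) (w - u) ≠ 0 := by
    intro h'; rw [he, h', mul_zero] at hcr; exact lt_irrefl _ hcr
  obtain ⟨p, hpV, hpu, hpv, hpt, s, hs0, hs1, hps, hempty, hmin⟩ :=
    exists_first_point hS hcross huv huw hfree hw fun q hq hqs =>
      hV.eq_or_eq_of_mem_segment hu hv hq hqs
  set c := u + s • (w - u)
  have hpt' : p ∈ triangle u v c :=
    (convex_triangle u v c).segment_subset (mid_mem_triangle _ _ _) (right_mem_triangle _ _ _) hps
  have hup : Visible S u p := visible_of_disjoint_triangle hempty (left_mem_triangle _ _ _) hpt'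
  have hvp : Visible S v p := visible_of_disjoint_triangle hempty (mid_mem_triangle _ _ _) hpt'
  have hmin' : ∀ q ∈ V, q ≠ u → q ∈ triangle u v w → 0 ≤ coordCross j k (p - v) (q - v) := by
    intro q hq hqu hqt
    have h1 := hmin q hq hqu hqt
    have h2 : coordCross j k (p - v) (q - v) * coordCross j k (v - u) (w - u) ≤ 0 := by
      rw [he, he]
      have : 0 ≤ σ ^ 2 := sq_nonneg σ
      nlinarith
    by_contra hcon
    push Not at hcon
    nlinarith
  have hvc' := h.mem_positiveCone_iff.1 hvc
  have hwc' := h.mem_positiveCone_iff.1 hwc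
  have hwi := mem_positiveCone_coord_pos hwc
  obtain ⟨β, γ, hβ, hγ, hβγ, hpe⟩ := hpt
  have hpu' : p - u = β • (v - u) + γ • (w - u) := by rw [hpe]; abel
  have hcp : ∀ l, coord l (p - u) = β * coord l (v - u) + γ * coord l (w - u) := by
    intro l
    rw [hpu', map_add, map_smul, map_smul, smul_eq_mul, smul_eq_mul]
  have hpj : coord j (p - u) ≤ 0 := by
    rw [hcp]
    nlinarith [hvc'.2.1, hwc'.2.1]
  have hpk : coord k (p - u) ≤ 0 := by
    rw [hcp]
    nlinarith [hvc'.2.2, hwc'.2.2]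
  have hpi : coord i (p - u) ≤ coord i (w - u) := by
    rw [hcp]
    nlinarith
  have hpcone : p ∈ positiveCone u i := h.mem_positiveCone_iff.2 ⟨hpu, hpj, hpk⟩
  have hβ1 : β < 1 := by
    refine lt_of_le_of_ne (by linarith) fun hb => hpv ?_
    have : γ = 0 := by linarith
    rw [hpe, hb, this]; module
  have hpw : coordCross j k (p - u) (w - u) = β * coordCross j k (v - u) (w - u) := by
    simp only [coordCross, hcp]; ring
  have hγ0 : 0 < γ := by
    refine lt_of_le_of_ne hγ fun hg => ?_
    have : p ∈ segment ℝ u v := by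
      rw [segment_eq_image']
      exact ⟨β, ⟨hβ, by linarith⟩, by rw [hpe, ← hg]; simp⟩
    rcases hV.eq_or_eq_of_mem_segment hu hv hpV this with h' | h'
    · exact hpu h'
    · exact hpv h'
  have hstep : ChainStep V S i j k u w v p :=
    { left_mem := hv
      right_mem := hpV
      ne := hpv.symm
      visible := hvp
      left_j := lt_of_le_of_ne hvc'.2.1 (hV.coord_ne_zero hu hv hvc'.1.symm j)
      left_k := lt_of_le_of_ne hvc'.2.2 (hV.coord_ne_zero hu hv hvc'.1.symm k)
      right_j := lt_of_le_of_ne hpj (hV.coord_ne_zero hu hpV hpu.symm j)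
      right_k := lt_of_le_of_ne hpk (hV.coord_ne_zero hu hpV hpu.symm k)
      right_le := hpi
      left_cross := hcr
      right_cross := by rw [hpw]; nlinarith
      step_cross := by
        have : coordCross j k (p - v) (w - u) = -((1 - β) * coordCross j k (v - u) (w - u)) := by
          rw [show p - v = (p - u) - (v - u) by abel, coordCross_sub_left, hpw]; ring
        rw [this]; nlinarith
      cross_step := by
        have : coordCross j k (v - u) (p - v) = γ * coordCross j k (v - u) (w - u) := by
          rw [show p - v = (p - u) - (v - u) by abel, coordCross_sub_right]
          simp only [coordCross, hcp]; ring
        rw [this]; nlinarith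
      right_triangle := ⟨β, γ, hβ, hγ, hβγ, hpe⟩
      min := hmin' }
  have hfree' : ∀ z ∈ segment ℝ v p, IsFreeDirection S u z := fun z hz =>
    (visible_of_disjoint_triangle hempty (left_mem_triangle _ _ _)
      ((convex_triangle u v c).segment_subset (mid_mem_triangle _ _ _) hpt' hz)).isFreeDirection
  refine ⟨p, ?_, hpcone, hup, hfree'⟩
  by_cases hpw' : p = w
  · subst hpw'
    exact .last hstep
  have hβ0 : 0 < β := by
    refine lt_of_le_of_ne hβ fun hb => ?_
    have : p ∈ segment ℝ u w := by
      rw [segment_eq_image']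
      exact ⟨γ, ⟨hγ, by linarith⟩, by rw [hpe, ← hb]; simp⟩
    rcases hV.eq_or_eq_of_mem_segment hu hw hpV this with h' | h'
    · exact hpu h'
    · exact hpw' h'
  have hsub : ∀ q, q ∈ triangle u p w → q ∈ triangle u v w := by
    rintro q ⟨β', γ', h1, h2, h3, rfl⟩
    refine ⟨β' * β, β' * γ + γ', by positivity, by positivity, by nlinarith, ?_⟩
    rw [hpu']; module
  have hvnot : v ∉ triangle u p w := by
    rintro ⟨β', γ', h1, h2, h3, hve⟩
    have h4 : coordCross j k (v - u) (w - u) = β' * (β * coordCross j k (v - u) (w - u)) := by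
      rw [← hpw]
      conv_lhs => rw [show v - u = β' • (p - u) + γ' • (w - u) by
        conv_lhs => rw [hve]
        abel]
      simp only [coordCross, map_add, map_smul, smul_eq_mul]; ring
    have h5 : β' * β < 1 := by nlinarith
    nlinarith
  obtain ⟨q, hq, -, -, -⟩ := ih (V.filter (· ∈ triangle u p w)).card (by
      rw [← hn]
      refine Finset.card_lt_card ⟨?_, ?_⟩
      · intro q hq
        rw [Finset.mem_filter] at hq ⊢
        exact ⟨hq.1, hsub q hq.2⟩
      · intro hcon
        have := hcon (Finset.mem_filter.2 ⟨hv, mid_mem_triangle u v w⟩)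
        exact hvnot (Finset.mem_filter.1 this).2)
    hpV hup hpcone hpi (by rw [hpw]; nlinarith) (by
      intro z hz
      rw [segment_eq_image'] at hz
      obtain ⟨t, ⟨ht0, ht1⟩, rfl⟩ := hz
      have hk : 0 < (1 - t) * β + ((1 - t) * γ + t) := by
        rcases ht1.eq_or_lt with rfl | ht1
        · linarith
        · have := mul_pos (sub_pos.2 ht1) hβ0
          have := mul_nonneg (sub_pos.2 ht1).le hγ
          linarith
      refine (hfree (v + (((1 - t) * γ + t) / ((1 - t) * β + ((1 - t) * γ + t))) • (w - v))
        ?_).smul hk ?_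
      · rw [segment_eq_image']
        have h1 := mul_nonneg (sub_nonneg.2 ht1) hγ
        have h2 := mul_nonneg (sub_nonneg.2 ht1) hβ
        refine ⟨_, ⟨div_nonneg (by linarith) hk.le, ?_⟩, rfl⟩
        rw [div_le_one hk]; linarith
      · have e1 : p + t • (w - p) - u = ((1 - t) * β) • (v - u) + ((1 - t) * γ + t) • (w - u) := by
          rw [show p + t • (w - p) - u = (1 - t) • (p - u) + t • (w - u) by module, hpu']; module
        rw [e1, add_sub_right_comm, smul_add, smul_smul, mul_div_cancel₀ _ hk.ne']
        module)
    rfl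
  refine .cons hstep hq ?_
  have hqs := hq.step
  have := hmin' q hqs.right_mem (by
    rintro rfl
    have := hqs.right_j
    simp at this) (hsub q hqs.right_triangle)
  rw [show q - p = (q - v) - (p - v) by abel, coordCross_sub_right]
  have h0 : coordCross j k (p - v) (p - v) = 0 := by simp only [coordCross]; ring
  rw [h0, sub_zero]
  exact this

end chains

/-! ### Walks along convex chains -/

/-- For a vector `z` of the `i`-th cone, where `j` and `k` are the other two indices, the length of
the way from the apex of the canonical triangle of `z` to `z` along its sides, around its corner
with `coord j = 0`. The linear form is used for all vectors: if `-z` lies in the `j`-th cone, then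
`sideCost j k z` is `sideCost i k (-z)`. -/
noncomputable def sideCost (j k : Fin 3) (z : Plane) : ℝ := (-4 * coord j z - 2 * coord k z) / √3

/-- The part of the canonical triangle of `u` and `w` that lies on the side of its corner with
`coord k = 0` contains no point of `V`. -/
def SideEmpty (V : Finset Plane) (i j k : Fin 3) (u w : Plane) : Prop :=
  ∀ q ∈ V, coord j (q - u) ≤ 0 → coord k (q - u) ≤ 0 → coord i (q - u) ≤ coord i (w - u) →
    0 ≤ coordCross j k (w - u) (q - u)

/-- The bounds on the distance of `u` and `w` in the half-`Θ₆`-graph that are proved by induction on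
the size of the canonical triangle: the way along its sides around the corner with `coord j = 0`, if
the part on the other side of `uw` contains no points of `V`, and the longer of the ways around the
two corners in any case. -/
def WalkBound (V : Finset Plane) (S : Finset SimplePolygon) (i j k : Fin 3) (u w : Plane) : Prop :=
  (SideEmpty V i j k u w → HasWalk V S u w (sideCost j k (w - u))) ∧
    HasWalk V S u w (max (sideCost j k (w - u)) (sideCost k j (w - u)))

/-- The bounds hold for all visible pairs of points of `V` with canonical triangles of height less
than `m`. -/
def WalkBoundBelow (V : Finset Plane) (S : Finset SimplePolygon) (m : ℝ) : Prop :=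
  ∀ i u w, u ∈ V → w ∈ V → w ∈ positiveCone u i → Visible S u w → coord i (w - u) < m →
    ∀ j k, IsTriple i j k → WalkBound V S i j k u w

section bounds

variable {V : Finset Plane} {S : Finset SimplePolygon} {i j k : Fin 3} {u w v p q : Plane}

lemma sideCost_eq (h : IsTriple i j k) (z : Plane) :
    sideCost j k z = √3 * coord i z + (coord k z - coord j z) / √3 := by
  have h3 : √3 * √3 = 3 := Real.mul_self_sqrt (by norm_num)
  have h0 : √3 ≠ 0 := by simp
  have hs := h.sum_eq z
  rw [sideCost, show coord i z = -(coord j z + coord k z) by linarith]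
  field_simp
  linear_combination (coord j z + coord k z) * h3

lemma sideCost_sub (j k : Fin 3) (z z' : Plane) :
    sideCost j k (z - z') = sideCost j k z - sideCost j k z' := by
  simp only [sideCost, map_sub]; ring

lemma sideCost_le_sideCost {z : Plane} (hz : coord j z ≤ coord k z) :
    sideCost k j z ≤ sideCost j k z := by
  unfold sideCost
  gcongr ?_ / _
  linarith

lemma norm_le_sideCost (h : IsTriple i j k) {z : Plane} (hj : coord j z ≤ 0) (hk : coord k z ≤ 0) :
    ‖z‖ ≤ sideCost j k z := by
  have h3 : √3 ^ 2 = 3 := Real.sq_sqrt (by norm_num)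
  have hs := h.sum_eq z
  refine le_of_sq_le_sq ?_ (div_nonneg (by linarith) (by positivity))
  rw [h.norm_sq, sideCost, div_pow, h3, show coord i z = -(coord j z + coord k z) by linarith]
  nlinarith [mul_nonneg_of_nonpos_of_nonpos hj hk]

lemma coordCross_swap (j k : Fin 3) (z z' : Plane) :
    coordCross j k z z' = -coordCross j k z' z := by
  simp only [coordCross]; ring

lemma IsTriple.coordCross_left (h : IsTriple i j k) (z z' : Plane) :
    coordCross i k z z' = -coordCross j k z z' := by
  have h1 := h.sum_eq z
  have h2 := h.sum_eq z'
  simp only [coordCross]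
  rw [show coord i z = -(coord j z + coord k z) by linarith,
    show coord i z' = -(coord j z' + coord k z') by linarith]
  ring

namespace ChainStep

lemma left_pos (h : IsTriple i j k) (hs : ChainStep V S i j k u w v p) : 0 < coord i (v - u) := by
  have := h.sum_eq (v - u)
  linarith [hs.left_j, hs.left_k]

/-- A step that leads into the negative `j`-th cone is bounded by the way around one fixed side of
its canonical triangle, since the other side of this triangle contains no points of `V`. -/
lemma hasWalk_of_pos (h : IsTriple i j k) (hs : ChainStep V S i j k u w v p)
    (hIH : WalkBoundBelow V S (coord i (w - u)))
    (hi : 0 < coord i (p - v)) (hk : 0 < coord k (p - v)) :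
    HasWalk V S v p (sideCost j k (p - v)) := by
  have hz := h.sum_eq (v - p)
  have hzi : coord i (v - p) < 0 := by rw [map_sub] at hi ⊢; linarith
  have hzk : coord k (v - p) < 0 := by rw [map_sub] at hk ⊢; linarith
  have hcone : v ∈ positiveCone p j :=
    h.left.mem_positiveCone_iff.2 ⟨hs.ne, hzi.le, hzk.le⟩
  have hlt : coord j (v - p) < coord i (w - u) := by
    have h1 := h.sum_eq (p - u)
    have h2 := hs.left_j
    have h3 := hs.right_k
    have h4 := hs.right_le
    simp only [map_sub] at *
    linarith
  have hB := hIH j p v hs.right_mem hs.left_mem hcone hs.visible.symm hlt i k h.left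
  have hcost : sideCost i k (v - p) = sideCost j k (p - v) := by
    unfold sideCost
    congr 1
    simp only [map_sub] at *
    linarith
  rw [← hcost]
  refine (hB.1 ?_).symm
  intro q hq hyi hyk hyj
  by_contra hcon
  push Not at hcon
  have hy := h.sum_eq (q - p)
  have hykz : coord k (v - p) < coord k (q - p) := by
    by_contra hle
    push Not at hle
    have : coord i (v - p) ≤ coord i (q - p) := by linarith
    simp only [coordCross] at hcon
    nlinarith
  rw [h.coordCross_left] at hcon
  -- such a point `q` would lie in the triangle `u`, `v`, `p`
  have h3 : coordCross j k (p - v) (q - v) < 0 := by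
    have : coordCross j k (p - v) (q - v) = -coordCross j k (v - p) (q - p) := by
      simp only [coordCross, map_sub]; ring
    linarith
  have hqt : q ∈ triangle u v p := by
    refine mem_triangle_of_coordCross h ?_ ?_ ?_ h3.le
    · have : coordCross j k (v - u) (p - u) = coordCross j k (v - u) (p - v) := by
        simp only [coordCross, map_sub]; ring
      rw [this]; exact hs.cross_step
    · have e : coordCross j k (v - u) (q - u) = coordCross j k (v - u) (q - v) := by
        simp only [coordCross, map_sub]; ring
      have h1 : 0 < coord k (q - v) := by simp only [map_sub] at *; linarith
      have h2 : coord j (q - v) ≤ 0 := by simp only [map_sub] at *; linarith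
      rw [e, coordCross]
      nlinarith [hs.left_j, hs.left_k]
    · have e : coordCross j k (q - u) (p - u) = coordCross j k (q - p) (p - u) := by
        simp only [coordCross, map_sub]; ring
      have h1 : 0 ≤ coord j (q - p) := by linarith
      rw [e, coordCross]
      nlinarith [hs.right_j, hs.right_k]
  have hqu : q ≠ u := by
    rintro rfl
    have := hs.right_k
    simp only [map_sub] at *
    linarith
  obtain ⟨β, γ, hβ, hγ, hβγ, rfl⟩ := hqt
  have hqw : u + β • (v - u) + γ • (p - u) ∈ triangle u v w := by
    obtain ⟨β', γ', h1, h2, h4, hp⟩ := hs.right_triangle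
    refine ⟨β + γ * β', γ * γ', by positivity, by positivity, by nlinarith, ?_⟩
    rw [hp]; module
  have := hs.min _ hq hqu hqw
  linarith

/-- A step of the chain that leads into the `i`-th cone. -/
lemma walkBound_of_neg (h : IsTriple i j k) (hs : ChainStep V S i j k u w v p)
    (hIH : WalkBoundBelow V S (coord i (w - u)))
    (hj : coord j (p - v) < 0) (hk : coord k (p - v) < 0) : WalkBound V S i j k v p := by
  refine hIH i v p hs.left_mem hs.right_mem (h.mem_positiveCone_iff.2 ⟨hs.ne.symm, hj.le, hk.le⟩)
    hs.visible ?_ j k h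
  have := hs.left_pos h
  have := hs.right_le
  simp only [map_sub] at *
  linarith

lemma coord_j_neg (hs : ChainStep V S i j k u w v p) (hwj : coord j (w - u) < 0)
    (hwk : coord k (w - u) < 0) (hk : coord k (p - v) < 0) : coord j (p - v) < 0 := by
  have := hs.step_cross
  rw [coordCross] at this
  by_contra hcon
  push Not at hcon
  nlinarith

lemma hasWalk_max (h : IsTriple i j k) (hV : GeneralPosition V) (hs : ChainStep V S i j k u w v p)
    (hIH : WalkBoundBelow V S (coord i (w - u)))
    (hwj : coord j (w - u) < 0) (hwk : coord k (w - u) < 0) (hi : 0 < coord i (p - v)) :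
    HasWalk V S v p (max (sideCost j k (p - v)) (sideCost k j (p - v))) := by
  rcases lt_or_gt_of_ne (hV.coord_ne_zero hs.left_mem hs.right_mem hs.ne k) with hk | hk
  · exact (hs.walkBound_of_neg h hIH (hs.coord_j_neg hwj hwk hk) hk).2
  · exact (hs.hasWalk_of_pos h hIH hi hk).mono (le_max_left _ _)

/-- If the part of the canonical triangle of `u` and `w` beyond `uw` contains no points of `V`, the
same is true for each step of the chain: no points lie between the chain and `uw`. -/
lemma sideEmpty (h : IsTriple i j k) (hs : ChainStep V S i j k u w v p) (hw : w ∈ V)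
    (hwi : 0 < coord i (w - u))
    (hi : 0 < coord i (p - v)) (hside : SideEmpty V i j k u w) : SideEmpty V i j k v p := by
  intro q hq hqj hqk hqi
  by_contra hcon
  push Not at hcon
  have hsum := h.sum_eq (q - v)
  have hvpos := hs.left_pos h
  have hqi0 : 0 ≤ coord i (q - v) := by linarith
  have hwu : w ≠ u := by rintro rfl; simp at hwi
  have hew := hs.min w hw hwu (right_mem_triangle _ _ _)
  have hwv : 0 < coord i (w - v) := by
    have := hs.right_le
    simp only [map_sub] at *
    linarith
  have hqu : q ≠ u := by
    rintro rfl
    simp only [map_sub] at *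
    linarith
  have h1 := coord_mul_coordCross h i (p - v) (w - v) (q - v)
  have h2 := coord_mul_coordCross h i (p - v) (v - u) (q - v)
  have h3 := hs.cross_step
  rw [coordCross_swap] at h3
  have h4 := hside q hq (by have := hs.left_j; simp only [map_sub] at *; linarith)
    (by have := hs.left_k; simp only [map_sub] at *; linarith)
    (by have := hs.right_le; simp only [map_sub] at *; linarith)
  have hqt : q ∈ triangle u v w := by
    refine mem_triangle_of_coordCross h hs.left_cross ?_ ?_ ?_
    · have e : coordCross j k (v - u) (q - u) = coordCross j k (v - u) (q - v) := by
        simp only [coordCross, map_sub]; ring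
      rw [e]
      by_contra hc
      push Not at hc
      have := mul_pos hi hc
      have := mul_neg_of_pos_of_neg hvpos hcon
      have : 0 ≤ coord i (q - v) * coordCross j k (p - v) (v - u) := mul_nonneg hqi0 (by linarith)
      linarith
    · rw [coordCross_swap]; linarith
    · by_contra hc
      push Not at hc
      have := mul_pos hi hc
      have := mul_neg_of_pos_of_neg hwv hcon
      have := mul_nonneg hqi0 hew
      linarith
  have := hs.min q hq hqu hqt
  linarith

lemma hasWalk_side (h : IsTriple i j k) (hV : GeneralPosition V) (hs : ChainStep V S i j k u w v p)
    (hIH : WalkBoundBelow V S (coord i (w - u))) (hw : w ∈ V)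
    (hwj : coord j (w - u) < 0) (hwk : coord k (w - u) < 0) (hi : 0 < coord i (p - v))
    (hside : coord j (w - u) ≤ coord k (w - u) ∨ SideEmpty V i j k u w) :
    HasWalk V S v p (sideCost j k (p - v)) := by
  rcases lt_or_gt_of_ne (hV.coord_ne_zero hs.left_mem hs.right_mem hs.ne k) with hk | hk
  · have hj := hs.coord_j_neg hwj hwk hk
    have hB := hs.walkBound_of_neg h hIH hj hk
    rcases hside with hside | hside
    · have hle : coord j (p - v) ≤ coord k (p - v) := by
        have := hs.step_cross
        rw [coordCross] at this
        by_contra hcon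
        push Not at hcon
        nlinarith
      have := hB.2
      rwa [max_eq_left (sideCost_le_sideCost hle)] at this
    · have hsum := h.sum_eq (w - u)
      exact hB.1 (hs.sideEmpty h hw (by linarith) hi hside)
  · exact hs.hasWalk_of_pos h hIH hi hk

end ChainStep

/-- Every step of a convex chain is a nonnegative combination of the step before and of `w - u`. -/
lemma coord_next_step (h : IsTriple i j k) (l : Fin 3) :
    coord l (q - p) * coordCross j k (p - v) (w - u) =
      coord l (p - v) * coordCross j k (q - p) (w - u) +
        coord l (w - u) * coordCross j k (p - v) (q - p) := by
  rw [coord_mul_coordCross h, coordCross_swap j k (q - p) (p - v)]; ring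

lemma next_step_pos (h : IsTriple i j k)
    (hs : ChainStep V S i j k u w v p) (hq : ChainStep V S i j k u w p q)
    (hturn : 0 ≤ coordCross j k (p - v) (q - p)) (hwi : 0 < coord i (w - u))
    (hi : 0 < coord i (p - v)) : 0 < coord i (q - p) := by
  have h1 := coord_next_step (u := u) (v := v) (w := w) (p := p) (q := q) h i
  have h2 := hs.step_cross
  have h3 := mul_pos hi hq.step_cross
  have h4 := mul_nonneg hwi.le hturn
  by_contra hcon
  push Not at hcon
  nlinarith

namespace ConvexChain

/-- If all steps of the chain admit the way around the same side, the bounds add up. -/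
lemma hasWalk_side (h : IsTriple i j k) (hV : GeneralPosition V)
    (hc : ConvexChain V S i j k u w v p)
    (hIH : WalkBoundBelow V S (coord i (w - u))) (hw : w ∈ V)
    (hwj : coord j (w - u) < 0) (hwk : coord k (w - u) < 0) (hi : 0 < coord i (p - v))
    (hside : coord j (w - u) ≤ coord k (w - u) ∨ SideEmpty V i j k u w) :
    HasWalk V S v w (sideCost j k (w - v)) := by
  have hsum := h.sum_eq (w - u)
  induction hc with
  | last hs => exact hs.hasWalk_side h hV hIH hw hwj hwk hi hside
  | cons hs hq hturn ih =>
    have h1 := hs.hasWalk_side h hV hIH hw hwj hwk hi hside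
    have h2 := ih (next_step_pos h hs hq.step hturn (by linarith) hi)
    exact (h1.trans h2).mono (le_of_eq (by simp only [sideCost_sub]; ring))

/-- If the chain starts towards the side of `v`, and `w` lies on this side of the bisector, all
steps lead towards this side. -/
lemma hasWalk_of_turned (h : IsTriple i j k) (hV : GeneralPosition V)
    (hc : ConvexChain V S i j k u w v p)
    (hIH : WalkBoundBelow V S (coord i (w - u)))
    (hwj : coord j (w - u) < 0) (hwk : coord k (w - u) < 0) (hi : 0 < coord i (p - v))
    (hw : coord k (w - u) ≤ coord j (w - u)) (hp : coord k (p - v) ≤ coord j (p - v)) :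
    HasWalk V S v w (sideCost k j (w - v)) := by
  have hsum := h.sum_eq (w - u)
  induction hc with
  | last hs =>
    have := hs.hasWalk_max h hV hIH hwj hwk hi
    rwa [max_eq_right (sideCost_le_sideCost hp)] at this
  | @cons v p q hs hq hturn ih =>
    have h1 := hs.hasWalk_max h hV hIH hwj hwk hi
    rw [max_eq_right (sideCost_le_sideCost hp)] at h1
    have h2 := ih (next_step_pos h hs hq.step hturn (by linarith) hi) (by
      have e1 := coord_next_step (u := u) (v := v) (w := w) (p := p) (q := q) h j
      have e2 := coord_next_step (u := u) (v := v) (w := w) (p := p) (q := q) h k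
      have h3 := mul_le_mul_of_nonneg_right hp hq.step.step_cross.le
      have h4 := mul_le_mul_of_nonneg_right hw hturn
      exact le_of_mul_le_mul_right (by linarith) hs.step_cross)
    exact (h1.trans h2).mono (le_of_eq (by simp only [sideCost_sub]; ring))

/-- If `w` lies on the side of `v` of the bisector, the chain may lead away from this side at first,
but it turns back at most once, without crossing the bisector; the bounds of the steps up to the
turn are for one side, those of the later steps for the other. -/
lemma hasWalk_of_left (h : IsTriple i j k) (hV : GeneralPosition V)
    (hc : ConvexChain V S i j k u w v p)
    (hIH : WalkBoundBelow V S (coord i (w - u)))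
    (hwj : coord j (w - u) < 0) (hwk : coord k (w - u) < 0) (hi : 0 < coord i (p - v))
    (hw : coord k (w - u) ≤ coord j (w - u)) :
    HasWalk V S v w (sideCost k j (w - u) - sideCost j k (v - u)) := by
  have hsum := h.sum_eq (w - u)
  have h30 : 0 < √3 := by positivity
  have hleft : ∀ x : Plane, coord k (x - u) < 0 → coordCross j k (x - u) (w - u) ≤ 0 →
      coord k (x - u) ≤ coord j (x - u) := by
    intro x hxk hx
    rw [coordCross] at hx
    by_contra hcon
    push Not at hcon
    nlinarith
  have hbase : ∀ {v p : Plane}, ChainStep V S i j k u w v p →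
      HasWalk V S v w (sideCost k j (w - v)) →
      HasWalk V S v w (sideCost k j (w - u) - sideCost j k (v - u)) := by
    intro v p hs hwalk
    refine hwalk.mono ?_
    have := sideCost_le_sideCost (hleft v hs.left_k hs.left_cross.le)
    have e : sideCost k j (w - v) = sideCost k j (w - u) - sideCost k j (v - u) := by
      simp only [sideCost_sub]; ring
    linarith
  induction hc with
  | @last v hs =>
    have h1 := hs.hasWalk_max h hV hIH hwj hwk hi
    rcases le_total (coord k (w - v)) (coord j (w - v)) with hp | hp
    · rw [max_eq_right (sideCost_le_sideCost hp)] at h1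
      exact hbase hs h1
    · rw [max_eq_left (sideCost_le_sideCost hp)] at h1
      refine h1.mono ?_
      have := sideCost_le_sideCost hw
      have e : sideCost j k (w - v) = sideCost j k (w - u) - sideCost j k (v - u) := by
        simp only [sideCost_sub]; ring
      linarith
  | @cons v p q hs hq hturn ih =>
    rcases le_total (coord k (p - v)) (coord j (p - v)) with hp | hp
    · exact hbase hs ((ConvexChain.cons hs hq hturn).hasWalk_of_turned h hV hIH hwj hwk hi hw hp)
    · have h1 := hs.hasWalk_max h hV hIH hwj hwk hi
      rw [max_eq_left (sideCost_le_sideCost hp)] at h1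
      have h2 := ih (next_step_pos h hs hq.step hturn (by linarith) hi)
      exact (h1.trans h2).mono (le_of_eq (by simp only [sideCost_sub]; ring))

end ConvexChain

/-! ### The spanning ratio -/

/-- The inductive step: the bounds for `u` and `w` follow from those for smaller canonical
triangles, if the closest visible point `v` in the subcone of `w` lies on the same side of `uw` as
the boundary ray with `coord j = 0`. -/
lemma walkBound_step (hS : ∀ P ∈ S, P.corners ⊆ (V : Set Plane)) (hV : GeneralPosition V)
    (h : IsTriple i j k) (hu : u ∈ V) (hw : w ∈ V) (hwc : w ∈ positiveCone u i)
    (hvis : Visible S u w)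
    (hIH : WalkBoundBelow V S (coord i (w - u)))
    (hv : v ∈ V) (hvs : v ∈ subcone S u i w) (hvc : IsClosestInSubcone V S u i v)
    (hle : coord i (v - u) ≤ coord i (w - u)) (hcr : coordCross j k (v - u) (w - u) < 0) :
    WalkBound V S i j k u w ∧ WalkBound V S i k j u w := by
  have hwpos := mem_positiveCone_coord_pos hwc
  obtain ⟨hwu, hwj, hwk⟩ := h.mem_positiveCone_iff.1 hwc
  obtain ⟨hvu, hvj, hvk⟩ := h.mem_positiveCone_iff.1 hvc.1
  have hwj' : coord j (w - u) < 0 := lt_of_le_of_ne hwj (hV.coord_ne_zero hu hw hwu.symm j)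
  have hwk' : coord k (w - u) < 0 := lt_of_le_of_ne hwk (hV.coord_ne_zero hu hw hwu.symm k)
  obtain ⟨p, hc, hpcone, hup, hpfree⟩ := exists_convexChain hS hV h hu hw hvis hwc hv hvc.2.1 hvc.1
    hle hcr (fun z hz => hvs.2 z (segment_symm ℝ v w ▸ hz))
  have hi : 0 < coord i (p - v) := by
    have := hvc.2.2 p hc.step.right_mem hc.step.ne.symm ⟨hpcone, hpfree⟩ hup
    rw [projLength_eq, projLength_eq] at this
    simp only [map_sub] at *
    linarith
  have huv := hvc.hasWalk hu hv
  have hside : coord j (w - u) ≤ coord k (w - u) ∨ SideEmpty V i j k u w →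
      HasWalk V S u w (sideCost j k (w - u)) := by
    intro hside
    have h1 := hc.hasWalk_side h hV hIH hw hwj' hwk' hi hside
    refine (huv.trans h1).mono ?_
    have := norm_le_sideCost h hvj hvk
    have e : sideCost j k (w - v) = sideCost j k (w - u) - sideCost j k (v - u) := by
      simp only [sideCost_sub]; ring
    linarith
  -- the chain may turn back; the edge `uv` is then bounded by the way around the nearer corner
  have hmax : HasWalk V S u w (max (sideCost j k (w - u)) (sideCost k j (w - u))) := by
    rcases le_total (coord j (w - u)) (coord k (w - u)) with hw' | hw'
    · exact (hside (Or.inl hw')).mono (le_max_left _ _)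
    · have h1 := hc.hasWalk_of_left h hV hIH hwj' hwk' hi hw'
      refine (huv.trans h1).mono (le_trans ?_ (le_max_right _ _))
      have := norm_le_sideCost h hvj hvk
      linarith
  refine ⟨⟨fun he => hside (Or.inr he), hmax⟩, fun he => ?_,
    max_comm (sideCost j k (w - u)) _ ▸ hmax⟩
  exfalso
  have h1 := he v hv hvk hvj hle
  have e : coordCross k j (w - u) (v - u) = coordCross j k (v - u) (w - u) := by
    simp only [coordCross]; ring
  linarith

/-- The bounds hold for all visible pairs. The induction is on the number of triples of a cone and
two points of `V` with a canonical triangle of smaller height. -/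
theorem walkBound (hS : ∀ P ∈ S, P.corners ⊆ (V : Set Plane)) (hV : GeneralPosition V)
    (h : IsTriple i j k) (hu : u ∈ V) (hw : w ∈ V) (hwc : w ∈ positiveCone u i)
    (hvis : Visible S u w) : WalkBound V S i j k u w := by
  classical
  induction hn : ((Finset.univ ×ˢ V ×ˢ V).filter fun t : Fin 3 × Plane × Plane =>
      coord t.1 (t.2.2 - t.2.1) < coord i (w - u)).card using Nat.strong_induction_on
    generalizing i j k u w with
  | _ n ih =>
  have hIH : WalkBoundBelow V S (coord i (w - u)) := by
    intro i' u' w' hu' hw' hwc' hvis' hlt j' k' h'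
    refine ih _ ?_ h' hu' hw' hwc' hvis' rfl
    rw [← hn]
    refine Finset.card_lt_card ⟨?_, ?_⟩
    · intro t ht
      rw [Finset.mem_filter] at ht ⊢
      exact ⟨ht.1, ht.2.trans hlt⟩
    · intro hcon
      have hmem : (i', u', w') ∈ (Finset.univ ×ˢ V ×ˢ V).filter fun t : Fin 3 × Plane × Plane =>
          coord t.1 (t.2.2 - t.2.1) < coord i (w - u) := by
        rw [Finset.mem_filter]
        exact ⟨by simp [hu', hw'], hlt⟩
      have := hcon hmem
      rw [Finset.mem_filter] at this
      exact lt_irrefl _ this.2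
  obtain ⟨v, hv, hvs, hvc, hmin⟩ := exists_isClosestInSubcone hV hw hwc hvis
  obtain ⟨hwu, hwj, hwk⟩ := h.mem_positiveCone_iff.1 hwc
  by_cases hvw : v = w
  · subst hvw
    have hedge := hvc.hasWalk hu hv
    have h1 := norm_le_sideCost h hwj hwk
    exact ⟨fun _ => hedge.mono h1, hedge.mono (h1.trans (le_max_left _ _))⟩
  have hle : coord i (v - u) ≤ coord i (w - u) := by
    refine hmin w hw ⟨hwc, fun x hx => ?_⟩ hvis
    rw [segment_same] at hx
    rw [Set.mem_singleton_iff.1 hx]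
    exact hvis.isFreeDirection
  have hne : coordCross j k (v - u) (w - u) ≠ 0 := by
    obtain ⟨σ, hσ, he⟩ := h.coordCross_eq
    rw [he]
    exact mul_ne_zero hσ (hV.cross_ne_zero hu hv hw hvc.1.1.symm hvw hwu.symm)
  rcases lt_or_gt_of_ne hne with hcr | hcr
  · exact (walkBound_step hS hV h hu hw hwc hvis hIH hv hvs hvc hle hcr).1
  · refine (walkBound_step hS hV h.swap hu hw hwc hvis hIH hv hvs hvc hle ?_).2
    have e : coordCross k j (v - u) (w - u) = -coordCross j k (v - u) (w - u) := by
      simp only [coordCross]; ring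
    linarith

end bounds

section conclusion

variable {V : Finset Plane} {S : Finset SimplePolygon}

lemma canonicalMid_sub (u : Plane) (i : Fin 3) (v : Plane) :
    canonicalMid u i v - u = projLength u i v • bisector i := by
  have h3 : √3 ≠ 0 := by simp
  ext l
  rw [canonicalMid, midpoint_eq_smul_add]
  simp only [canonicalLeft, canonicalRight, leftBoundary, rightBoundary, bisector, unitDir,
    cos_pi_div_six]
  fin_cases l <;> simp [cos_add, cos_sub, sin_add, sin_sub] <;> field_simp <;> ring

lemma cos_angle_mid {u v : Plane} {i : Fin 3} (hv : v ∈ positiveCone u i) :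
    cos (∠ (canonicalMid u i v) u v) * ‖v - u‖ = coord i (v - u) := by
  have hpos := mem_positiveCone_coord_pos hv
  rw [EuclideanGeometry.angle, vsub_eq_sub, vsub_eq_sub, canonicalMid_sub, projLength_eq,
    InnerProductGeometry.angle_smul_left_of_pos _ _ hpos]
  have := InnerProductGeometry.cos_angle_mul_norm_mul_norm (bisector i) (v - u)
  rw [norm_bisector, one_mul] at this
  rw [this]
  rfl

/-- The longer way around the canonical triangle in terms of the angle at its apex. -/
lemma max_sideCost_le {u v : Plane} {i j k : Fin 3} (h : IsTriple i j k)
    (hv : v ∈ positiveCone u i) :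
    max (sideCost j k (v - u)) (sideCost k j (v - u)) ≤
      (√3 * cos (∠ (canonicalMid u i v) u v) + sin (∠ (canonicalMid u i v) u v)) * dist u v := by
  have hcos := cos_angle_mid hv
  have hsin : 0 ≤ sin (∠ (canonicalMid u i v) u v) := InnerProductGeometry.sin_angle_nonneg _ _
  have hsq := sin_sq_add_cos_sq (∠ (canonicalMid u i v) u v)
  rw [dist_comm, dist_eq_norm, add_mul, mul_assoc, hcos]
  set α := ∠ (canonicalMid u i v) u v
  have h3 : √3 ^ 2 = 3 := Real.sq_sqrt (by norm_num)
  have hs := h.sum_eq (v - u)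
  have hn := h.norm_sq (v - u)
  have habs : |(coord k (v - u) - coord j (v - u)) / √3| ≤ sin α * ‖v - u‖ := by
    refine abs_le_of_sq_le_sq ?_ (by positivity)
    have e : (sin α * ‖v - u‖) ^ 2 = ‖v - u‖ ^ 2 - coord i (v - u) ^ 2 := by
      rw [← hcos, mul_pow, mul_pow]
      linear_combination ‖v - u‖ ^ 2 * hsq
    rw [e, hn, div_pow, h3, show coord i (v - u) = -(coord j (v - u) + coord k (v - u)) by linarith]
    apply le_of_eq
    ring
  have h1 := abs_le.1 habs
  refine max_le ?_ ?_
  · rw [sideCost_eq h]; linarith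
  · rw [sideCost_eq h.swap]
    have : (coord j (v - u) - coord k (v - u)) / √3 =
      -((coord k (v - u) - coord j (v - u)) / √3) := by ring
    linarith

lemma sqrt_three_mul_cos_add_sin_le (α : ℝ) : √3 * cos α + sin α ≤ 2 := by
  have h3 : √3 ^ 2 = 3 := Real.sq_sqrt (by norm_num)
  have := sin_sq_add_cos_sq α
  refine le_of_sq_le_sq ?_ zero_le_two
  nlinarith [sq_nonneg (√3 * sin α - cos α)]

lemma exists_mem_positiveCone (hV : GeneralPosition V) {u v : Plane} (hu : u ∈ V) (hv : v ∈ V)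
    (huv : u ≠ v) : (∃ i, v ∈ positiveCone u i) ∨ ∃ i, u ∈ positiveCone v i := by
  have h0 : IsTriple 0 1 2 := by unfold IsTriple; decide
  have h1 : IsTriple 1 0 2 := by unfold IsTriple; decide
  have h2 : IsTriple 2 0 1 := by unfold IsTriple; decide
  have hs := h0.sum_eq (v - u)
  have hneg : ∀ l, coord l (u - v) = -coord l (v - u) := fun l => by rw [← map_neg, neg_sub]
  have key0 := h0.mem_positiveCone_iff (u := u) (x := v)
  have key1 := h1.mem_positiveCone_iff (u := u) (x := v)
  have key2 := h2.mem_positiveCone_iff (u := u) (x := v)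
  have key0' := h0.mem_positiveCone_iff (u := v) (x := u)
  have key1' := h1.mem_positiveCone_iff (u := v) (x := u)
  have key2' := h2.mem_positiveCone_iff (u := v) (x := u)
  simp only [hneg, Left.neg_nonpos_iff] at key0' key1' key2'
  rcases lt_or_gt_of_ne (hV.coord_ne_zero hu hv huv 0) with c0 | c0 <;>
    rcases lt_or_gt_of_ne (hV.coord_ne_zero hu hv huv 1) with c1 | c1 <;>
    rcases lt_or_gt_of_ne (hV.coord_ne_zero hu hv huv 2) with c2 | c2
  · linarith
  · exact Or.inl ⟨2, key2.2 ⟨huv.symm, c0.le, c1.le⟩⟩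
  · exact Or.inl ⟨1, key1.2 ⟨huv.symm, c0.le, c2.le⟩⟩
  · exact Or.inr ⟨0, key0'.2 ⟨huv, c1.le, c2.le⟩⟩
  · exact Or.inl ⟨0, key0.2 ⟨huv.symm, c1.le, c2.le⟩⟩
  · exact Or.inr ⟨1, key1'.2 ⟨huv, c0.le, c2.le⟩⟩
  · exact Or.inr ⟨2, key2'.2 ⟨huv, c0.le, c1.le⟩⟩
  · linarith

lemma walkLength_bypass_le {G : SimpleGraph V} [DecidableEq V] {x y : V} (p : G.Walk x y) :
    walkLength p.bypass ≤ walkLength p := by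
  have hnd : p.bypass.darts.Nodup :=
    List.Nodup.of_map (f := SimpleGraph.Dart.edge) p.bypass_isPath.isTrail.edges_nodup
  obtain ⟨l, hl, hsub⟩ := hnd.subperm p.darts_bypass_subset_darts
  rw [walkLength, walkLength, ← (hl.map _).sum_eq]
  refine (hsub.map _).sum_le_sum ?_
  simp only [List.mem_map]
  rintro _ ⟨d, -, rfl⟩
  exact dist_nonneg

lemma visible_of_adj {u v : V} (h : (visibilityGraph V S).Adj u v) :
    Visible S (u : Plane) v := by
  rcases h.2 with h | h
  · exact h
  · exact Visible.symm h

lemma halfThetaSix_le : halfThetaSix V S ≤ visibilityGraph V S := by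
  rintro a b ⟨hne, ⟨i, hi⟩ | ⟨i, hi⟩⟩
  · exact ⟨hne, Or.inl hi.2.1⟩
  · exact ⟨hne, Or.inr hi.2.1⟩

/-- Two visible points, one in a positive cone of the other, are joined by a walk of bounded length
in the half-`Θ₆`-graph. -/
theorem exists_walk_of_mem_positiveCone (hS : ∀ P ∈ S, P.corners ⊆ (V : Set Plane))
    (hV : GeneralPosition V) {u v : V} (hvis : Visible S (u : Plane) v) {i : Fin 3}
    (hv : (v : Plane) ∈ positiveCone u i) : ∃ p : (halfThetaSix V S).Walk u v,
      walkLength p ≤ (√3 * cos (∠ (canonicalMid u i v) (u : Plane) (v : Plane)) +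
        sin (∠ (canonicalMid u i v) (u : Plane) (v : Plane))) * dist (u : Plane) (v : Plane) := by
  obtain ⟨j, k, h⟩ := IsTriple.exists_of i
  obtain ⟨_, _, p, hp⟩ := (walkBound hS hV h u.2 v.2 hv hvis).2
  exact ⟨p, hp.trans (max_sideCost_le h hv)⟩

lemma sqrt_three_mul_cos_add_sin_mul_dist_le (α : ℝ) (u v : Plane) :
    (√3 * cos α + sin α) * dist u v ≤ 2 * dist u v :=
  mul_le_mul_of_nonneg_right (sqrt_three_mul_cos_add_sin_le α) dist_nonneg

theorem isSpanner_halfThetaSix (hS : ∀ P ∈ S, P.corners ⊆ (V : Set Plane))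
    (hV : GeneralPosition V) : IsSpanner 2 (halfThetaSix V S) (visibilityGraph V S) := by
  refine ⟨halfThetaSix_le, fun x y => ?_⟩
  have hedge : ∀ a b : V, (visibilityGraph V S).Adj a b → ∃ p : (halfThetaSix V S).Walk a b,
      walkLength p ≤ 2 * dist (a : Plane) b := by
    intro a b hab
    have hne : (a : Plane) ≠ b := fun h => hab.ne (Subtype.ext h)
    rcases exists_mem_positiveCone hV a.2 b.2 hne with ⟨i, hi⟩ | ⟨i, hi⟩
    · obtain ⟨p, hp⟩ := exists_walk_of_mem_positiveCone hS hV (visible_of_adj hab) hi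
      exact ⟨p, hp.trans (sqrt_three_mul_cos_add_sin_mul_dist_le _ _ _)⟩
    · obtain ⟨p, hp⟩ := exists_walk_of_mem_positiveCone hS hV (visible_of_adj hab.symm) hi
      refine ⟨p.reverse, ?_⟩
      rw [walkLength_reverse, dist_comm]
      exact hp.trans (sqrt_three_mul_cos_add_sin_mul_dist_le _ _ _)
  have hwalk : ∀ {x y : V} (p : (visibilityGraph V S).Walk x y),
      ∃ q : (halfThetaSix V S).Walk x y, walkLength q ≤ 2 * walkLength p := by
    intro x y p
    induction p with
    | nil => exact ⟨.nil, by simp [walkLength]⟩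
    | @cons a b c hab p ih =>
      obtain ⟨q, hq⟩ := ih
      obtain ⟨r, hr⟩ := hedge a b hab
      refine ⟨r.append q, ?_⟩
      have : walkLength (SimpleGraph.Walk.cons hab p) = dist (a : Plane) b + walkLength p := by
        simp [walkLength]
      rw [walkLength_append, this]
      linarith
  rw [graphDist, graphDist, ENNReal.mul_iInf_of_ne two_ne_zero (by simp)]
  refine le_iInf fun p => ?_
  obtain ⟨q, hq⟩ := hwalk p
  refine (iInf_le _ q).trans ((ENNReal.ofReal_le_ofReal hq).trans ?_)
  rw [ENNReal.ofReal_mul zero_le_two]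
  simp

end conclusion

theorem mainTheorem1 (V : Finset Plane) (S : Finset SimplePolygon)
    (hS : IsObstacleSet V S) (hV : GeneralPosition V) :
    IsPlane (halfThetaSix V S) ∧
    IsSpanner 2 (halfThetaSix V S) (visibilityGraph V S) ∧
    (∀ u v : V, (visibilityGraph V S).Adj u v →
      (∃ i : Fin 3, (v : Plane) ∈ positiveCone u i) ∨
      (∃ i : Fin 3, (u : Plane) ∈ positiveCone v i)) ∧
    (∀ u v : V, (visibilityGraph V S).Adj u v →
      ∀ i : Fin 3, (v : Plane) ∈ positiveCone u i →
        (∃ p : (halfThetaSix V S).Walk u v, p.IsPath ∧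
          walkLength p ≤
            (√3 * cos (∠ (canonicalMid u i v) (u : Plane) (v : Plane)) +
              sin (∠ (canonicalMid u i v) (u : Plane) (v : Plane))) *
              dist (u : Plane) (v : Plane)) ∧
        (√3 * cos (∠ (canonicalMid u i v) (u : Plane) (v : Plane)) +
            sin (∠ (canonicalMid u i v) (u : Plane) (v : Plane))) *
            dist (u : Plane) (v : Plane) ≤
          2 * dist (u : Plane) (v : Plane)) := by
  classical
  have hS' := hS.1
  refine ⟨isPlane_halfThetaSix hS' hV, isSpanner_halfThetaSix hS' hV, fun u v huv => ?_,
    fun u v huv i hi => ⟨?_, sqrt_three_mul_cos_add_sin_mul_dist_le _ _ _⟩⟩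
  · exact exists_mem_positiveCone hV u.2 v.2 fun h => huv.ne (Subtype.ext h)
  · obtain ⟨p, hp⟩ := exists_walk_of_mem_positiveCone hS' hV (visible_of_adj huv) hi
    exact ⟨p.bypass, p.bypass_isPath, (walkLength_bypass_le p).trans hp⟩
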